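/- **Setting.** Let $0\le\delta\le\frac12$ and write $v(\delta)=\frac12+\delta\sqrt{\frac{1+4\delta^2}{2}}$. A classical PUF (CPUF) of bias $\delta$ is a random function $f:\{0,1\}^n\to\{0,1\}^{2m}$ (the randomness is fixed at manufacturing) all of whose output bits, over all challenges and all positions, are independent and equal $0$ with probability $\frac12+\delta$. Write $f(x)=y^1\|y^2$ with $y^1,y^2\in\{0,1\}^m$. **Online protocol.** The Verifier holds a secret database of $d\ge1$ independent uniformly random challenges with their responses; the Prover holds the device. The Verifier sends a uniformly random challenge $x$ of the database. For each $j$ the device prepares $|\Phi^+\rangle=(|00\rangle+|11\rangle)/\sqrt2$ if $y^2_j=0$ and $|\Psi^-\rangle=(|01\rangle-|10\rangle)/\sqrt2$ if $y^2_j=1$. The Prover sends the first qubits to the Verifier, then measures the second ones in the $Z$ basis ($y^1_j=0$) or the Hadamard basis ($y^1_j=1$) and announces the outcomes $b_j$. The Verifier measures qubit $j$ in the basis given by $y^1_j$, with outcome $a_j$, and accepts iff for every $j$: $a_j=b_j$ when $y^2_j=0$ and $a_j\ne b_j$ when $y^2_j=1$. **Adversaries.** An adversary has a quantum memory of arbitrary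 finite dimension and may apply arbitrary quantum operations, with no bound on computing power. Before the challenge is issued it makes, adaptively, $q$ queries to the device: in the setup phase it obtains classical pairs $(x',f(x'))$, and afterwards, posing as the Verifier, it obtains the Prover's qubits and announced outcomes on challenges of its choice. After the challenge $x$ is issued it may seize the qubits that the Prover emits for $x$ (but not the Prover's announcement for $x$, so that simply relaying an honest run is not a forgery), may run any number of sessions with the Prover on challenges $x'\neq x$, and finally sends $m$ qubits and an $m$-bit string to the Verifier. **Theorem 4 (online protocol security).** 1. *Guessing game.* Alice flips two independent coins $c_1,c_2$, each $0$ with probability $\frac12+\delta$. Bob sends a qubit $\rho_b$ along with a bit $b$, chosen with a probability $q_b$. Alice measures the qubit in the $Z$ basis if $c_1=0$ and in the Hadamard basis if $c_1=1$, with outcome $a$; Bob wins if $a=b$ when $c_2=0$ and if $a\ne b$ when $c_2=1$. Bob's maximal winning probability is $v(\delta)$. 2. *Equivalence.* For $m=1$, the acceptance probabilities achieved by adversaries with $q=0$ are exactly the winning probabilities of Bob's strategies in this game. 3. *Local indistinguishability.* For every response, the $m$ qubits emitted by the Prover are in the state $I/2^m$. Hence, for a bit $y^2$ of any prior distribution $(w,1-w)$,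 the maximal probability of guessing it from its qubit is $\max(w,1-w)$, that of guessing without the qubit. 4. *Helstrom bound.* Given the announced outcome $b$ (either value) and the qubit sent, the maximal probability of guessing the basis bit $y^1$ is $\frac12+\delta$, that of guessing without them. 5. *Overall acceptance.* The maximal acceptance probability over adversaries with $q=0$ is $v(\delta)^m$. For every adversary, with any $q$, the probability that the Verifier accepts and the challenge had not been queried before it was issued is at most $v(\delta)^m$ times the probability that it had not been queried, and $$\Pr[\mathcal V\ \mathrm{accept}_{\mathcal A}]\le v(\delta)^m+\frac{q}{2^n}.$$ 6. *Security.* Let $\delta<\frac12$. Then $v(\delta)^m$ is negligible in $m$. If $n=n(\lambda)$ and $m=m(\lambda)$ both grow faster than $\log\lambda$, then every family of adversaries with $q=q(\lambda)$ bounded by a polynomial (in particular every family that is QPT in the setup phase and makes polynomially many queries to the Prover before the challenge, and is otherwise unbounded) is accepted with probability negligible in $\lambda$. -/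

import Mathlib

open scoped Kronecker ComplexOrder

noncomputable section

namespace OnlineAuth

/-! ### Qubits, Bell states, local measurements -/

/-- Bit strings of length `k`; also the computational basis labels of a `k`-qubit register. -/
abbrev Bits (k : ℕ) : Type := Fin k → Bool

/-- Density operators on the finite-dimensional space with basis `a`. -/
def IsDensity {a : Type} [Fintype a] (ρ : Matrix a a ℂ) : Prop :=
  ρ.PosSemidef ∧ ρ.trace = 1

/-- The ket of outcome `o` in the basis selected by `c`:
`|0⟩, |1⟩` for `c = 0` (`Z` basis) and `|+⟩, |-⟩` for `c = 1` (Hadamard basis). -/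
def basisKet (c o : Bool) : Bool → ℂ := fun s =>
  if c then (if o && s then -1 else 1) / (Real.sqrt 2 : ℂ) else (if s = o then 1 else 0)

/-- The rank one projector of outcome `o` in the basis selected by `c`. -/
def qubitProj (c o : Bool) : Matrix Bool Bool ℂ :=
  Matrix.vecMulVec (basisKet c o) (star (basisKet c o))

/-- The encoding of a bit: `0 ↦ |Φ⁺⟩ = (|00⟩ + |11⟩)/√2` and `1 ↦ |Ψ⁻⟩ = (|01⟩ - |10⟩)/√2`.
The first qubit is the Verifier's, the second one the Prover's. -/
def bellKet (e : Bool) : Bool × Bool → ℂ := fun vp =>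
  if e then
    (if vp = (false, true) then 1 else if vp = (true, false) then -1 else 0) / (Real.sqrt 2 : ℂ)
  else (if vp.1 = vp.2 then 1 else 0) / (Real.sqrt 2 : ℂ)

/-- The density operator of the encoded two-qubit state. -/
def bellState (e : Bool) : Matrix (Bool × Bool) (Bool × Bool) ℂ :=
  Matrix.vecMulVec (bellKet e) (star (bellKet e))

/-- Partial trace over the second tensor factor. -/
def partialTrace {a b : Type} [Fintype b] (ρ : Matrix (a × b) (a × b) ℂ) : Matrix a a ℂ :=
  fun i j => ∑ k, ρ (i, k) (j, k)

/-- The Verifier's qubit of the encoded state of the bit `e`. -/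
def sentQubit (e : Bool) : Matrix Bool Bool ℂ := partialTrace (bellState e)

/-- The unnormalised state of the Verifier's qubit of the encoded state of `e` after the Prover's
qubit was measured in the basis `c` with outcome `b`; its trace is the probability of `b`. -/
def measuredQubit (c e b : Bool) : Matrix Bool Bool ℂ :=
  partialTrace ((1 ⊗ₖ qubitProj c b) * bellState e * (1 ⊗ₖ qubitProj c b))

/-- Tensor product of `m` single-qubit operators. -/
def qubitTensor {m : ℕ} (M : Fin m → Matrix Bool Bool ℂ) : Matrix (Bits m) (Bits m) ℂ :=
  fun s t => ∏ j, M j (s j) (t j)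

/-! ### Classical PUFs and the hybrid entangled PUF -/

/-- A classical PUF, as a probabilistic function: `n`-bit challenges, `l`-bit responses, and random
coins fixed once at manufacturing. -/
structure ClassicalPUF (n l : ℕ) where
  Coin : Type
  coins : PMF Coin
  eval : Coin → Bits n → Bits l

/-- A bit with bias `δ`: it is `0` with probability `1/2 + δ`. -/
def bitProb (δ : ℝ) (b : Bool) : ℝ := if b then 1 / 2 - δ else 1 / 2 + δ

/-- The probability that the manufactured device has the challenge-response table `g`. -/
def ClassicalPUF.tableProb {n l : ℕ} (P : ClassicalPUF n l) (g : Bits n → Bits l) : ℝ :=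
  ((P.coins.map P.eval) g).toReal

/-- All response bits (over all challenges and positions) are independent, each of bias `δ`. -/
def ClassicalPUF.HasBias {n l : ℕ} (P : ClassicalPUF n l) (δ : ℝ) : Prop :=
  ∀ g : Bits n → Bits l, P.tableProb g = ∏ x, ∏ j, bitProb δ (g x j)

/-- The first half `y¹` of a response (measurement bases). -/
def basisPart {m : ℕ} (y : Bits (m + m)) : Bits m := fun j => y (Fin.castAdd m j)

/-- The second half `y²` of a response (encoded bits). -/
def encodedPart {m : ℕ} (y : Bits (m + m)) : Bits m := fun j => y (Fin.natAdd m j)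

/-- HEPUF, mode 0: the classical response `y = y¹ ‖ y²`, held in a classical register. -/
def crpResponse {m : ℕ} (y : Bits (m + m)) : Matrix (Bits m × Bits m) (Bits m × Bits m) ℂ :=
  Matrix.single (basisPart y, encodedPart y) (basisPart y, encodedPart y) 1

/-- HEPUF, mode 1: the Verifier's qubits of the encoding of `y²`. -/
def sentState {m : ℕ} (y : Bits (m + m)) : Matrix (Bits m) (Bits m) ℂ :=
  qubitTensor fun j => sentQubit (encodedPart y j)

/-- HEPUF, mode 1 followed by mode 2: the Verifier's qubits, together with the classical outcome
string `b` of measuring the Prover's qubits in the bases `y¹`, which the Prover announces. -/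
def sessionResponse {m : ℕ} (y : Bits (m + m)) :
    Matrix (Bits m × Bits m) (Bits m × Bits m) ℂ :=
  ∑ b : Bits m,
    (qubitTensor fun j => measuredQubit (basisPart y j) (encodedPart y j) (b j)) ⊗ₖ
      Matrix.single b b 1

/-- The Verifier's acceptance operator, given the response `y` from the database and the announced
string `b`: measure qubit `j` in the basis `y¹ⱼ`, obtain `aⱼ`, and accept iff for every `j`
`aⱼ = bⱼ` when `y²ⱼ = 0` and `aⱼ ≠ bⱼ` when `y²ⱼ = 1`. -/
def acceptOp {m : ℕ} (y : Bits (m + m)) (b : Bits m) : Matrix (Bits m) (Bits m) ℂ :=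
  ∑ a : Bits m with ∀ j, (a j ^^ b j) = encodedPart y j,
    qubitTensor fun j => qubitProj (basisPart y j) (a j)

/-! ### Quantum operations and adversaries -/

/-- A quantum instrument with outcomes in `O`, from the space with basis `a` to the space with
basis `b`, given by Kraus operators. -/
structure Instrument (O a b : Type) [Fintype O] [Fintype a] [DecidableEq a] [Fintype b] where
  num : ℕ
  kraus : O → Fin num → Matrix b a ℂ
  complete : ∑ o, ∑ k, (kraus o k).conjTranspose * kraus o k = 1

section Operations

variable {O a b : Type} [Fintype O] [Fintype a] [DecidableEq a] [Fintype b]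

/-- The unnormalised output state for the outcome `o`. -/
def Instrument.apply (I : Instrument O a b) (o : O) (ρ : Matrix a a ℂ) : Matrix b b ℂ :=
  ∑ k, I.kraus o k * ρ * (I.kraus o k).conjTranspose

end Operations

/-- A quantum channel. -/
abbrev Channel (a b : Type) [Fintype a] [DecidableEq a] [Fintype b] : Type := Instrument Unit a b

/-- An adaptive interaction with an oracle that takes a classical query from `C` and answers with a
state of the register `R`. The first two numbers are the dimensions of the memory before and
after, the last one is the number of queries. In each step the query is the outcome of an arbitrary
instrument on the memory, and an arbitrary channel then acts on memory and answer. -/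
inductive Interaction (C R : Type) [Fintype C] [Fintype R] [DecidableEq R] : ℕ → ℕ → ℕ → Type
  | done (d : ℕ) : Interaction C R d d 0
  | query {d d' d'' e q : ℕ} (ask : Instrument C (Fin d) (Fin d'))
      (absorb : Channel (Fin d' × R) (Fin d'')) (rest : Interaction C R d'' e q) :
      Interaction C R d e (q + 1)

/-- The unnormalised final memory state of an interaction with the oracle `answer`, on the event
that all queries lie in `S`. -/
def Interaction.run {C R : Type} [Fintype C] [Fintype R] [DecidableEq R]
    (answer : C → Matrix R R ℂ) (S : Finset C) :
    {d e q : ℕ} → Interaction C R d e q → Matrix (Fin d) (Fin d) ℂ → Matrix (Fin e) (Fin e) ℂ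
  | _, _, _, .done _, ρ => ρ
  | _, _, _, .query ask absorb rest, ρ =>
      rest.run answer S (absorb.apply () (∑ c ∈ S, ask.apply c ρ ⊗ₖ answer c))

/-- An adversary with unlimited quantum memory and computing power.
* `setup`: the adversary holds the device and collects challenge-response pairs of its choice.
* `sessions`: posing as the Verifier, the adversary sends challenges of its choice to the Prover
  and receives the qubits and the announced outcomes.
* Then the Verifier issues the challenge `x`. The adversary seizes the qubits that the Prover emits
  for `x` (`intercept`), runs any number of further sessions with the Prover on challenges different
  from `x` (`late`), and finally sends qubits and a bit string to the Verifier (`forge`). -/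
structure Adversary (n m : ℕ) where
  dim₀ : ℕ
  dim₁ : ℕ
  dim₂ : ℕ
  start : Matrix (Fin dim₀) (Fin dim₀) ℂ
  start_density : IsDensity start
  setupQueries : ℕ
  setup : Interaction (Bits n) (Bits m × Bits m) dim₀ dim₁ setupQueries
  sessionQueries : ℕ
  sessions : Interaction (Bits n) (Bits m × Bits m) dim₁ dim₂ sessionQueries
  dim₃ : Bits n → ℕ
  dim₄ : Bits n → ℕ
  intercept : ∀ x, Channel (Fin dim₂ × Bits m) (Fin (dim₃ x))
  lateQueries : Bits n → ℕ
  late : ∀ x, Interaction {x' : Bits n // x' ≠ x} (Bits m × Bits m) (dim₃ x) (dim₄ x)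
    (lateQueries x)
  forge : ∀ x, Instrument (Bits m) (Fin (dim₄ x)) (Bits m)

section Experiment

variable {n m : ℕ}

/-- The number of interactions with the device before the challenge is issued. -/
def Adversary.queries (A : Adversary n m) : ℕ := A.setupQueries + A.sessionQueries

/-- The memory when the challenge is issued, for the table `g`, on the event that all earlier
queries lie in `S`. -/
def Adversary.memory (A : Adversary n m) (g : Bits n → Bits (m + m)) (S : Finset (Bits n)) :
    Matrix (Fin A.dim₂) (Fin A.dim₂) ℂ :=
  A.sessions.run (fun x => sessionResponse (g x)) S
    (A.setup.run (fun x => crpResponse (g x)) S A.start)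

/-- The unnormalised state of the qubits sent to the Verifier when the challenge is `x` and the
memory is `ρ`, on the event that the string sent is `b`. -/
def Adversary.forgery (A : Adversary n m) (g : Bits n → Bits (m + m)) (x : Bits n)
    (ρ : Matrix (Fin A.dim₂) (Fin A.dim₂) ℂ) (b : Bits m) : Matrix (Bits m) (Bits m) ℂ :=
  (A.forge x).apply b
    ((A.late x).run (fun x' => sessionResponse (g x'.1)) Finset.univ
      ((A.intercept x).apply () (ρ ⊗ₖ sentState (g x))))

/-- Probability that the Verifier accepts, for the table `g` and the challenge `x`, jointly with the
event that all queries before the challenge lie in `S`. -/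
def Adversary.acceptOn (A : Adversary n m) (g : Bits n → Bits (m + m)) (x : Bits n)
    (S : Finset (Bits n)) : ℝ :=
  (∑ b : Bits m, (acceptOp (g x) b * A.forgery g x (A.memory g S) b).trace).re

/-- Expectation over the device, over a secret database of `d` independent uniformly random
challenges, and over the Verifier's uniformly random choice of a challenge in the database. -/
def expectation (P : ClassicalPUF n (m + m)) (d : ℕ)
    (F : (Bits n → Bits (m + m)) → Bits n → ℝ) : ℝ :=
  ∑ g, P.tableProb g *
    ((∑ D : Fin d → Bits n, (∑ i, F g (D i)) / (d : ℝ)) / (Fintype.card (Fin d → Bits n) : ℝ))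

/-- Probability that the Verifier accepts the adversary. -/
def acceptProb (P : ClassicalPUF n (m + m)) (d : ℕ) (A : Adversary n m) : ℝ :=
  expectation P d fun g x => A.acceptOn g x Finset.univ

/-- Probability that the adversary did not use the Verifier's challenge before it was issued. -/
def freshProb (P : ClassicalPUF n (m + m)) (d : ℕ) (A : Adversary n m) : ℝ :=
  expectation P d fun g x => (A.memory g (Finset.univ.erase x)).trace.re

/-- Probability that the Verifier accepts and the adversary did not use the Verifier's challenge
before it was issued. -/
def freshAcceptProb (P : ClassicalPUF n (m + m)) (d : ℕ) (A : Adversary n m) : ℝ :=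
  expectation P d fun g x => A.acceptOn g x (Finset.univ.erase x)

end Experiment

/-! ### The guessing game and state discrimination -/

/-- Bob's strategy: he sends the bit `b` with probability `q b`, along with the qubit `ρ b`. -/
structure GameStrategy where
  q : Bool → ℝ
  q_nonneg : ∀ b, 0 ≤ q b
  q_sum : ∑ b, q b = 1
  ρ : Bool → Matrix Bool Bool ℂ
  density : ∀ b, IsDensity (ρ b)

/-- Bob's winning probability. Alice flips two independent coins `c₁`, `c₂` of bias `δ`, measures
the qubit in the basis `c₁` and gets `a`; Bob wins if `a = b` when `c₂ = 0`, and if `a ≠ b` when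
`c₂ = 1`. -/
def GameStrategy.winProb (s : GameStrategy) (δ : ℝ) : ℝ :=
  ∑ c₁ : Bool, ∑ c₂ : Bool, ∑ b : Bool, ∑ a : Bool,
    if (a ^^ b) = c₂ then
      bitProb δ c₁ * bitProb δ c₂ * s.q b * ((qubitProj c₁ a * s.ρ b).trace).re
    else 0

/-- The set of probabilities of correctly identifying a qubit state that is `ρ₀` with probability
`w` and `ρ₁` with probability `1 - w`, over all two-outcome measurements `{E, 1 - E}`. -/
def discriminationProbs (w : ℝ) (ρ₀ ρ₁ : Matrix Bool Bool ℂ) : Set ℝ :=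
  {p | ∃ E : Matrix Bool Bool ℂ, E.PosSemidef ∧ (1 - E).PosSemidef ∧
    p = w * ((E * ρ₀).trace).re + (1 - w) * (((1 - E) * ρ₁).trace).re}

/-- The unnormalised state of the Verifier's qubit, for an encoded bit of bias `δ`, when the
Prover's measurement in the basis `c` gave the outcome `b`. -/
def unnormCollapsed (δ : ℝ) (c b : Bool) : Matrix Bool Bool ℂ :=
  ∑ e : Bool, (bitProb δ e : ℂ) • measuredQubit c e b

/-- The normalised state of the Verifier's qubit in this situation. -/
def collapsedQubit (δ : ℝ) (c b : Bool) : Matrix Bool Bool ℂ :=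
  ((unnormCollapsed δ c b).trace)⁻¹ • unnormCollapsed δ c b

/-- The claimed optimal forging probability per bit. -/
def forgeValue (δ : ℝ) : ℝ := 1 / 2 + δ * Real.sqrt ((1 + 4 * δ ^ 2) / 2)

end OnlineAuth

end

open OnlineAuth

open OnlineAuth

namespace OnlineAuth

open Matrix

/-! ### Positive semidefinite matrices and traces -/

section Trace

variable {a : Type} [Fintype a]

/-! Everything rests on averaging over the response to a challenge `x` that was not queried
beforehand. Nothing about that response reaches the adversary: the memory restricted to other
queries does not involve it, the seized qubits are maximally mixed whatever it is (`sentState_eq`),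
and the late sessions avoid `x`. It can therefore be resampled independently
(`sum_biasedTableProb_resample`). Since its bits are independent, the averaged acceptance operator
for an announced string `b` is the tensor product of the one-qubit operators `averageProj δ (b j)`
(`sum_responseProb_smul_acceptOp`).

Each factor is `1/2 ± δ N`, where `N` is real symmetric with diagonal `1/2 + δ`, `-(1/2 + δ)` and
off-diagonal `1/2 - δ`. As `N² = (1/2 + δ)² + (1/2 - δ)²`, its top eigenvalue is `forgeValue δ`. The
tensor product is then at most `forgeValue δ ^ m` in the Loewner order, so entangling the qubits
does not help, and a product of top eigenvectors attains the bound. Bob's game evaluates the same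
functional at `m = 1` on pairs of positive operators of total trace one, which gives both the game
value and the equivalence.

With queries, the weight of the runs that asked `x`, summed over `x`, is at most their number
(`Interaction.sum_trace_lost_le`); the challenge is uniform, whence the term `q / 2 ^ n`. For `δ <
1/2` the base is below one, and exponents growing faster than `log` beat every power.

The guessing bounds are separate: the two emitted qubits are equal, and for the basis bit the
weighted difference of the two states is positive, so the constant guess is optimal. -/

theorem trace_re_nonneg {M : Matrix a a ℂ} (hM : M.PosSemidef) : 0 ≤ (M.trace).re :=
  (Complex.nonneg_iff.mp hM.trace_nonneg).1

theorem trace_eq_re {M : Matrix a a ℂ} (hM : M.PosSemidef) : M.trace = ((M.trace).re : ℂ) :=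
  Complex.ext rfl (Complex.nonneg_iff.mp hM.trace_nonneg).2.symm

variable [DecidableEq a]

theorem exists_conjTranspose_mul_self {M : Matrix a a ℂ} (hM : M.PosSemidef) :
    ∃ B : Matrix a a ℂ, M = B.conjTranspose * B := by
  open scoped MatrixOrder in
  obtain ⟨B, hB⟩ := CStarAlgebra.nonneg_iff_eq_star_mul_self.mp hM.nonneg
  exact ⟨B, hB⟩

/-- Writing `M = Bᴴ B`, cyclicity turns the trace into that of `B A Bᴴ`. -/
theorem trace_mul_re_nonneg {A M : Matrix a a ℂ} (hA : A.PosSemidef) (hM : M.PosSemidef) :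
    0 ≤ ((A * M).trace).re := by
  obtain ⟨B, rfl⟩ := exists_conjTranspose_mul_self hM
  rw [← Matrix.mul_assoc, Matrix.trace_mul_comm, ← Matrix.mul_assoc]
  exact (Complex.nonneg_iff.mp (hA.mul_mul_conjTranspose_same B).trace_nonneg).1

theorem trace_mul_re_le {A M : Matrix a a ℂ} {k : ℝ}
    (hA : ((k : ℂ) • (1 : Matrix a a ℂ) - A).PosSemidef) (hM : M.PosSemidef) :
    ((A * M).trace).re ≤ k * (M.trace).re := by
  have h := trace_mul_re_nonneg hA hM
  rw [Matrix.sub_mul, Matrix.smul_mul, Matrix.one_mul, Matrix.trace_sub, Matrix.trace_smul] at h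
  simp only [smul_eq_mul, Complex.sub_re, Complex.mul_re, Complex.ofReal_re, Complex.ofReal_im,
    zero_mul, sub_zero] at h
  linarith

end Trace

/-! ### Real symmetric single-qubit operators -/

/-- The real symmetric operator with diagonal `p`, `q` and off-diagonal entry `r`. -/
def realSym (p q r : ℝ) : Matrix Bool Bool ℂ := fun i j =>
  ((if i then (if j then q else r) else (if j then r else p) : ℝ) : ℂ)

/-- Schur complement: for `p > 0` the matrix is a rank one term plus the diagonal remainder `q - r²
/ p`; for `p = 0` the hypothesis forces `r = 0`. -/
theorem realSym_posSemidef {p q r : ℝ} (hp : 0 ≤ p) (hq : 0 ≤ q) (h : r ^ 2 ≤ p * q) :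
    (realSym p q r).PosSemidef := by
  rcases hp.eq_or_lt with rfl | hp'
  · have hr : r = 0 := by nlinarith
    have : realSym 0 q r = Matrix.diagonal (fun i : Bool => ((if i then q else 0 : ℝ) : ℂ)) := by
      ext i j; cases i <;> cases j <;> simp [realSym, hr]
    rw [this]
    refine Matrix.PosSemidef.diagonal fun i => ?_
    cases i <;> simp [hq]
  · have e : realSym p q r =
        ((p⁻¹ : ℝ) : ℂ) • Matrix.vecMulVec (fun i : Bool => ((if i then r else p : ℝ) : ℂ))
          (star fun i : Bool => ((if i then r else p : ℝ) : ℂ)) +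
        Matrix.diagonal (fun i : Bool => ((if i then q - r ^ 2 / p else 0 : ℝ) : ℂ)) := by
      have : (p : ℂ) ≠ 0 := by exact_mod_cast hp'.ne'
      ext i j
      cases i <;> cases j <;> simp [realSym, Matrix.vecMulVec_apply] <;>
        (field_simp; try ring)
    rw [e]
    refine ((Matrix.posSemidef_vecMulVec_self_star _).smul ?_).add
      (Matrix.PosSemidef.diagonal fun i => ?_)
    · exact_mod_cast (inv_pos.mpr hp').le
    · have : 0 ≤ q - r ^ 2 / p := by
        rw [sub_nonneg, div_le_iff₀ hp']; linarith
      cases i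
      · simp
      · exact Complex.zero_le_real.mpr this

theorem realSym_add (p q r p' q' r' : ℝ) :
    realSym p q r + realSym p' q' r' = realSym (p + p') (q + q') (r + r') := by
  ext i j; cases i <;> cases j <;> simp [realSym]

theorem realSym_sub (p q r p' q' r' : ℝ) :
    realSym p q r - realSym p' q' r' = realSym (p - p') (q - q') (r - r') := by
  ext i j; cases i <;> cases j <;> simp [realSym]

theorem smul_realSym (k p q r : ℝ) :
    (k : ℂ) • realSym p q r = realSym (k * p) (k * q) (k * r) := by
  ext i j; cases i <;> cases j <;> simp [realSym]

theorem one_eq_realSym : (1 : Matrix Bool Bool ℂ) = realSym 1 1 0 := by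
  ext i j; cases i <;> cases j <;> simp [realSym]

theorem realSym_trace (p q r : ℝ) : (realSym p q r).trace = ((p + q : ℝ) : ℂ) := by
  simp [Matrix.trace, realSym, add_comm]

theorem realSym_mul_trace (p q r p' q' r' : ℝ) :
    (realSym p q r * realSym p' q' r').trace = ((p * p' + q * q' + 2 * (r * r') : ℝ) : ℂ) := by
  simp [Matrix.trace, Matrix.mul_apply, realSym]; ring

theorem inv_sqrt_two_mul_self : ((Real.sqrt 2 : ℂ))⁻¹ * ((Real.sqrt 2 : ℂ))⁻¹ = 1 / 2 := by
  rw [← mul_inv, ← Complex.ofReal_mul, Real.mul_self_sqrt (by norm_num)]; norm_num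

theorem qubitProj_false (o : Bool) :
    qubitProj false o = realSym (if o then 0 else 1) (if o then 1 else 0) 0 := by
  ext i j
  cases i <;> cases j <;> cases o <;> simp [qubitProj, basisKet, realSym, Matrix.vecMulVec_apply]

theorem qubitProj_true (o : Bool) :
    qubitProj true o = realSym (1 / 2) (1 / 2) (if o then -(1 / 2) else 1 / 2) := by
  have := inv_sqrt_two_mul_self
  ext i j
  cases i <;> cases j <;> cases o <;>
    simp [qubitProj, basisKet, realSym, Matrix.vecMulVec_apply, div_eq_mul_inv] <;>
    simpa using this

theorem qubitProj_posSemidef (c o : Bool) : (qubitProj c o).PosSemidef :=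
  Matrix.posSemidef_vecMulVec_self_star _

theorem qubitProj_sum (c : Bool) : ∑ o, qubitProj c o = 1 := by
  rw [Fintype.sum_bool, one_eq_realSym]
  cases c <;> simp only [qubitProj_false, qubitProj_true, realSym_add] <;> norm_num

theorem bellState_apply (e : Bool) (v p v' p' : Bool) :
    bellState e (v, p) (v', p') =
      if p = (v ^^ e) ∧ p' = (v' ^^ e) then (if e && (v ^^ v') then -(1 / 2) else 1 / 2) else 0 := by
  have := inv_sqrt_two_mul_self
  cases e <;> cases v <;> cases p <;> cases v' <;> cases p' <;>
    simp [bellState, bellKet, Matrix.vecMulVec_apply, div_eq_mul_inv] <;> simpa using this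

theorem sentQubit_eq (e : Bool) : sentQubit e = ((2 : ℂ)⁻¹) • 1 := by
  ext i j
  cases e <;> cases i <;> cases j <;> simp [sentQubit, partialTrace, bellState_apply]

/-- Both Bell states keep their correlation in the two bases: `Φ⁺` gives equal outcomes, `Ψ⁻`
opposite ones. The factor `1/2` is the probability of `b`. -/
theorem measuredQubit_eq (c e b : Bool) :
    measuredQubit c e b = ((1 / 2 : ℝ) : ℂ) • qubitProj c (b ^^ e) := by
  ext i j
  cases c <;> cases e <;> cases b <;> cases i <;> cases j <;>
    simp [measuredQubit, partialTrace, Matrix.mul_apply, Fintype.sum_prod_type,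
      bellState_apply, qubitProj_false, qubitProj_true, realSym, Matrix.kroneckerMap_apply,
      Matrix.one_apply] <;> norm_num

/-! ### The averaged acceptance operator of one qubit -/

/-- The average, over a basis bit and an encoded bit of bias `δ`, of the operator that accepts a
qubit announced with the bit `b`. -/
noncomputable def averageProj (δ : ℝ) (b : Bool) : Matrix Bool Bool ℂ :=
  ∑ c : Bool, ∑ e : Bool, ((bitProb δ c * bitProb δ e : ℝ) : ℂ) • qubitProj c (e ^^ b)

theorem averageProj_eq (δ : ℝ) (b : Bool) :
    averageProj δ b =
      realSym (1 / 2 + (if b then -1 else 1) * (δ * (1 / 2 + δ)))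
        (1 / 2 - (if b then -1 else 1) * (δ * (1 / 2 + δ)))
        ((if b then -1 else 1) * (δ * (1 / 2 - δ))) := by
  cases b <;>
    simp only [averageProj, Fintype.sum_bool, Bool.xor_false, Bool.xor_true, Bool.not_true,
      Bool.not_false, qubitProj_false, qubitProj_true, smul_realSym, realSym_add, bitProb,
      if_true, if_false, Bool.false_eq_true] <;>
    congr 1 <;> ring

theorem forgeValue_eq (δ : ℝ) :
    forgeValue δ = 1 / 2 + δ * Real.sqrt ((1 / 2 + δ) ^ 2 + (1 / 2 - δ) ^ 2) := by
  rw [forgeValue]; congr 3; ring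

theorem bitProb_nonneg {δ : ℝ} (h₀ : 0 ≤ δ) (h₁ : δ ≤ 1 / 2) (b : Bool) : 0 ≤ bitProb δ b := by
  cases b <;> simp only [bitProb, if_true, if_false, Bool.false_eq_true] <;> linarith

theorem bitProb_sum (δ : ℝ) : ∑ b, bitProb δ b = 1 := by
  simp [bitProb]; ring

theorem averageProj_posSemidef {δ : ℝ} (h₀ : 0 ≤ δ) (h₁ : δ ≤ 1 / 2) (b : Bool) :
    (averageProj δ b).PosSemidef := by
  refine Matrix.posSemidef_sum _ fun c _ => Matrix.posSemidef_sum _ fun e _ =>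
    (qubitProj_posSemidef _ _).smul ?_
  exact_mod_cast mul_nonneg (bitProb_nonneg h₀ h₁ c) (bitProb_nonneg h₀ h₁ e)

theorem forgeValue_sub_averageProj_posSemidef {δ : ℝ} (h₀ : 0 ≤ δ) (b : Bool) :
    ((forgeValue δ : ℂ) • (1 : Matrix Bool Bool ℂ) - averageProj δ b).PosSemidef := by
  rw [averageProj_eq, one_eq_realSym, smul_realSym, realSym_sub, forgeValue_eq]
  set k := Real.sqrt ((1 / 2 + δ) ^ 2 + (1 / 2 - δ) ^ 2) with hk
  have hk2 : k ^ 2 = (1 / 2 + δ) ^ 2 + (1 / 2 - δ) ^ 2 := Real.sq_sqrt (by positivity)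
  have hk1 : 1 / 2 + δ ≤ k := Real.le_sqrt_of_sq_le (by nlinarith [sq_nonneg (1 / 2 - δ)])
  have h3 : 0 ≤ δ * (k - (1 / 2 + δ)) := mul_nonneg h₀ (by linarith)
  have h4 : 0 ≤ δ * (k + (1 / 2 + δ)) := mul_nonneg h₀ (by linarith)
  -- The determinant vanishes, since `forgeValue δ` is an eigenvalue; the diagonal entries are the
  -- two factors, in an order that depends on `b`.
  have h5 : (δ * (1 / 2 - δ)) ^ 2 = δ * (k - (1 / 2 + δ)) * (δ * (k + (1 / 2 + δ))) := by
    linear_combination -(δ ^ 2) * hk2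
  apply realSym_posSemidef <;> cases b <;>
    simp only [if_true, if_false, Bool.false_eq_true] <;> nlinarith

/-- The projector on the optimal eigenvector of `averageProj δ false`. -/
noncomputable def optimalQubit (δ : ℝ) : Matrix Bool Bool ℂ :=
  realSym (1 / 2 + (1 / 2 + δ) / (2 * Real.sqrt ((1 / 2 + δ) ^ 2 + (1 / 2 - δ) ^ 2)))
    (1 / 2 - (1 / 2 + δ) / (2 * Real.sqrt ((1 / 2 + δ) ^ 2 + (1 / 2 - δ) ^ 2)))
    ((1 / 2 - δ) / (2 * Real.sqrt ((1 / 2 + δ) ^ 2 + (1 / 2 - δ) ^ 2)))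

theorem optimalQubit_density {δ : ℝ} (h₀ : 0 ≤ δ) : IsDensity (optimalQubit δ) := by
  have hk2 := Real.sq_sqrt (show 0 ≤ (1 / 2 + δ) ^ 2 + (1 / 2 - δ) ^ 2 by positivity)
  have hk1 : 1 / 2 + δ ≤ Real.sqrt ((1 / 2 + δ) ^ 2 + (1 / 2 - δ) ^ 2) :=
    Real.le_sqrt_of_sq_le (by nlinarith [sq_nonneg (1 / 2 - δ)])
  unfold optimalQubit
  set k := Real.sqrt ((1 / 2 + δ) ^ 2 + (1 / 2 - δ) ^ 2)
  have hk : 0 < k := by linarith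
  have h6 : (1 / 2 + δ) / (2 * k) ≤ 1 / 2 := by
    rw [div_le_iff₀ (by positivity)]; linarith
  have h7 : 0 ≤ (1 / 2 + δ) / (2 * k) := by positivity
  refine ⟨realSym_posSemidef (by linarith) (by linarith) (le_of_eq ?_), ?_⟩
  · field_simp
    linear_combination -4 * hk2
  · rw [realSym_trace]; norm_num

theorem averageProj_mul_optimalQubit_trace {δ : ℝ} (h₀ : 0 ≤ δ) :
    (averageProj δ false * optimalQubit δ).trace = (forgeValue δ : ℂ) := by
  have hk2 := Real.sq_sqrt (show 0 ≤ (1 / 2 + δ) ^ 2 + (1 / 2 - δ) ^ 2 by positivity)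
  have hk1 : 1 / 2 + δ ≤ Real.sqrt ((1 / 2 + δ) ^ 2 + (1 / 2 - δ) ^ 2) :=
    Real.le_sqrt_of_sq_le (by nlinarith [sq_nonneg (1 / 2 - δ)])
  rw [averageProj_eq, forgeValue_eq, optimalQubit, realSym_mul_trace]
  set k := Real.sqrt ((1 / 2 + δ) ^ 2 + (1 / 2 - δ) ^ 2)
  have hk : 0 < k := by linarith
  congr 1
  simp only [if_false, Bool.false_eq_true]
  field_simp
  linear_combination (-8 * δ) * hk2

/-! ### The guessing game and state discrimination -/

/-- A win with `c₂ = e` means `a = e ^^ b`, so both coins can be averaged into a single operator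
that depends only on `b`. -/
theorem winProb_eq (s : GameStrategy) (δ : ℝ) :
    s.winProb δ = ∑ b, s.q b * ((averageProj δ b * s.ρ b).trace).re := by
  simp only [GameStrategy.winProb, averageProj, Fintype.sum_bool, Matrix.add_mul, Matrix.smul_mul,
    Matrix.trace_add, Matrix.trace_smul, smul_eq_mul, Complex.add_re, Complex.re_ofReal_mul,
    Bool.xor_false, Bool.xor_true, Bool.not_true, Bool.not_false, if_true, if_false,
    Bool.false_eq_true, reduceCtorEq]
  ring

theorem isGreatest_winProb {δ : ℝ} (h₀ : 0 ≤ δ) :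
    IsGreatest {p : ℝ | ∃ s : GameStrategy, s.winProb δ = p} (forgeValue δ) := by
  constructor
  · refine ⟨⟨fun b => if b then 0 else 1, fun b => by cases b <;> simp, by simp,
      fun _ => optimalQubit δ, fun _ => optimalQubit_density h₀⟩, ?_⟩
    simp [winProb_eq, averageProj_mul_optimalQubit_trace h₀]
  · rintro _ ⟨s, rfl⟩
    rw [winProb_eq]
    calc _ ≤ ∑ b, s.q b * forgeValue δ := by
          refine Finset.sum_le_sum fun b _ => mul_le_mul_of_nonneg_left ?_ (s.q_nonneg b)
          have := trace_mul_re_le (forgeValue_sub_averageProj_posSemidef h₀ b) (s.density b).1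
          simpa [(s.density b).2] using this
      _ = forgeValue δ := by rw [← Finset.sum_mul, s.q_sum, one_mul]

/-- The two states coincide, so success is `w t + (1 - w)(1 - t)` with `t = tr E / 2` in `[0, 1]`:
affine in `t`, hence maximal at an endpoint. -/
theorem isGreatest_discriminationProbs_maximallyMixed (w : ℝ) :
    IsGreatest (discriminationProbs w (sentQubit false) (sentQubit true)) (max w (1 - w)) := by
  have key : ∀ E : Matrix Bool Bool ℂ,
      w * ((E * sentQubit false).trace).re + (1 - w) * (((1 - E) * sentQubit true).trace).re =
        w * ((E.trace).re / 2) + (1 - w) * (1 - (E.trace).re / 2) := by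
    intro E
    simp only [sentQubit_eq, Matrix.mul_smul, Matrix.mul_one, Matrix.trace_smul, Matrix.trace_sub,
      Matrix.trace_one, smul_eq_mul, Fintype.card_bool]
    have : (2 : ℂ)⁻¹ = ((2⁻¹ : ℝ) : ℂ) := by norm_num
    rw [this, Complex.re_ofReal_mul, Complex.re_ofReal_mul]
    simp
    ring
  constructor
  · rcases le_total w (1 - w) with h | h
    · refine ⟨0, Matrix.PosSemidef.zero, by simpa using Matrix.PosSemidef.one, ?_⟩
      rw [key, max_eq_right h]; simp
    · refine ⟨1, Matrix.PosSemidef.one, by simpa using Matrix.PosSemidef.zero, ?_⟩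
      rw [key, max_eq_left h]; simp
  · rintro p ⟨E, hE, hE', rfl⟩
    rw [key]
    have h1 := trace_re_nonneg hE
    have h2 := trace_re_nonneg hE'
    simp only [Matrix.trace_sub, Matrix.trace_one, Fintype.card_bool, Complex.sub_re] at h2
    norm_num at h2
    have h3 := le_max_left w (1 - w)
    have h4 := le_max_right w (1 - w)
    nlinarith

/-- The Bloch vector has length `2δ`, along the axis of the measured basis, with sign given by `b`;
the encoded bit's bias is all that remains. -/
theorem collapsedQubit_eq (δ : ℝ) (c b : Bool) :
    collapsedQubit δ c b = if c then
        realSym (1 / 2) (1 / 2) ((if b then -1 else 1) * δ)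
      else realSym (1 / 2 + (if b then -1 else 1) * δ) (1 / 2 - (if b then -1 else 1) * δ) 0 := by
  have h : unnormCollapsed δ c b = ((1 / 2 : ℝ) : ℂ) • (if c then
        realSym (1 / 2) (1 / 2) ((if b then -1 else 1) * δ)
      else realSym (1 / 2 + (if b then -1 else 1) * δ) (1 / 2 - (if b then -1 else 1) * δ) 0) := by
    cases c <;> cases b <;>
      simp only [unnormCollapsed, Fintype.sum_bool, measuredQubit_eq, Bool.xor_false,
        Bool.xor_true, Bool.not_true, Bool.not_false, qubitProj_false, qubitProj_true,
        smul_realSym, realSym_add, bitProb, if_true, if_false, Bool.false_eq_true] <;>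
      congr 1 <;> ring
  have ht : (unnormCollapsed δ c b).trace = ((1 / 2 : ℝ) : ℂ) := by
    rw [h, Matrix.trace_smul]
    cases c <;> simp only [if_true, if_false, Bool.false_eq_true, realSym_trace] <;> norm_num
  rw [collapsedQubit, ht, h, smul_smul, inv_mul_cancel₀ (by norm_num), one_smul]

theorem isGreatest_discriminationProbs_collapsedQubit {δ : ℝ} (h₀ : 0 ≤ δ) (h₁ : δ ≤ 1 / 2)
    (b : Bool) :
    IsGreatest
      (discriminationProbs (1 / 2 + δ) (collapsedQubit δ false b) (collapsedQubit δ true b))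
      (1 / 2 + δ) := by
  have t0 : ((collapsedQubit δ false b).trace) = 1 := by
    rw [collapsedQubit_eq]
    simp only [if_false, Bool.false_eq_true, realSym_trace]; norm_num
  -- Helstrom's operator has no negative part, so no measurement improves on always guessing basis
  -- `0`. Its determinant is twice the quantity in `h3`.
  have hpos : (((1 / 2 + δ : ℝ) : ℂ) • collapsedQubit δ false b -
      ((1 - (1 / 2 + δ) : ℝ) : ℂ) • collapsedQubit δ true b).PosSemidef := by
    rw [collapsedQubit_eq, collapsedQubit_eq]
    simp only [if_true, if_false, Bool.false_eq_true, smul_realSym, realSym_sub]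
    have h2 : 0 ≤ δ * (1 / 2 - δ) := mul_nonneg h₀ (by linarith)
    have h3 : δ ^ 2 * ((1 / 2 - δ) * (1 / 2 + δ)) ≥ 0 :=
      mul_nonneg (sq_nonneg _) (mul_nonneg (by linarith) (by linarith))
    apply realSym_posSemidef <;> cases b <;>
      simp only [if_true, if_false, Bool.false_eq_true] <;> nlinarith
  constructor
  · refine ⟨1, Matrix.PosSemidef.one, by simpa using Matrix.PosSemidef.zero, ?_⟩
    simp [t0]
  · rintro p ⟨E, hE, hE', rfl⟩
    have h := trace_mul_re_nonneg hE' hpos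
    rw [Matrix.mul_sub, Matrix.mul_smul, Matrix.mul_smul, Matrix.trace_sub, Matrix.trace_smul,
      Matrix.trace_smul, smul_eq_mul, smul_eq_mul, Complex.sub_re, Complex.re_ofReal_mul,
      Complex.re_ofReal_mul] at h
    have h4 : (((1 - E) * collapsedQubit δ false b).trace).re =
        1 - ((E * collapsedQubit δ false b).trace).re := by
      rw [Matrix.sub_mul, Matrix.one_mul, Matrix.trace_sub, t0]; simp
    rw [h4] at h
    linarith

/-! ### Tensor products of single-qubit operators -/

section Tensor

variable {m : ℕ}

theorem qubitTensor_mul (M N : Fin m → Matrix Bool Bool ℂ) :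
    qubitTensor M * qubitTensor N = qubitTensor fun j => M j * N j := by
  ext s t
  simp only [qubitTensor, Matrix.mul_apply, ← Finset.prod_mul_distrib]
  rw [Fintype.prod_sum]

theorem qubitTensor_conjTranspose (M : Fin m → Matrix Bool Bool ℂ) :
    (qubitTensor M).conjTranspose = qubitTensor fun j => (M j).conjTranspose := by
  ext s t
  simp [qubitTensor, Matrix.conjTranspose_apply]

theorem qubitTensor_posSemidef {M : Fin m → Matrix Bool Bool ℂ} (h : ∀ j, (M j).PosSemidef) :
    (qubitTensor M).PosSemidef := by
  choose B hB using fun j => exists_conjTranspose_mul_self (h j)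
  rw [funext hB, ← qubitTensor_mul, ← qubitTensor_conjTranspose]
  exact Matrix.posSemidef_conjTranspose_mul_self _

theorem qubitTensor_sum {κ : Type} [Fintype κ] [DecidableEq κ]
    (M : Fin m → κ → Matrix Bool Bool ℂ) :
    (qubitTensor fun j => ∑ k, M j k) = ∑ u : Fin m → κ, qubitTensor fun j => M j (u j) := by
  ext s t
  simp only [qubitTensor, Matrix.sum_apply, Fintype.prod_sum]

theorem qubitTensor_smul (k : Fin m → ℂ) (M : Fin m → Matrix Bool Bool ℂ) :
    (qubitTensor fun j => k j • M j) = (∏ j, k j) • qubitTensor M := by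
  ext s t
  simp [qubitTensor, Finset.prod_mul_distrib]

theorem qubitTensor_one : (qubitTensor fun _ : Fin m => (1 : Matrix Bool Bool ℂ)) = 1 := by
  ext s t
  by_cases h : s = t
  · subst h; simp [qubitTensor, Matrix.one_apply_eq]
  · obtain ⟨j, hj⟩ := Function.ne_iff.mp h
    rw [Matrix.one_apply_ne h]
    exact Finset.prod_eq_zero (Finset.mem_univ j) (Matrix.one_apply_ne hj)

theorem qubitTensor_trace (M : Fin m → Matrix Bool Bool ℂ) :
    (qubitTensor M).trace = ∏ j, (M j).trace := by
  simp only [Matrix.trace, Matrix.diag_apply, qubitTensor, Fintype.prod_sum]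

/-- Expand the tensor power of `k • 1 = M j + (k • 1 - M j)`: `qubitTensor M` is one of the `2 ^ m`
terms, and all the others are tensor products of positive operators. -/
theorem smul_one_sub_qubitTensor_posSemidef {k : ℝ} {M : Fin m → Matrix Bool Bool ℂ}
    (h : ∀ j, (M j).PosSemidef)
    (h' : ∀ j, ((k : ℂ) • (1 : Matrix Bool Bool ℂ) - M j).PosSemidef) :
    (((k ^ m : ℝ) : ℂ) • (1 : Matrix (Bits m) (Bits m) ℂ) - qubitTensor M).PosSemidef := by
  let N : Fin m → Bool → Matrix Bool Bool ℂ := fun j t =>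
    if t then (k : ℂ) • (1 : Matrix Bool Bool ℂ) - M j else M j
  have hN : ∀ j t, (N j t).PosSemidef := by
    intro j t; cases t
    · exact h j
    · exact h' j
  have e : (((k ^ m : ℝ) : ℂ) • (1 : Matrix (Bits m) (Bits m) ℂ)) =
      ∑ u : Fin m → Bool, qubitTensor fun j => N j (u j) := by
    rw [← qubitTensor_sum]
    have : ∀ j, ∑ t, N j t = (k : ℂ) • (1 : Matrix Bool Bool ℂ) := by
      intro j; simp [N]
    rw [funext this, qubitTensor_smul, qubitTensor_one]
    simp
  have e' : qubitTensor M = qubitTensor fun j => N j ((fun _ => false : Fin m → Bool) j) := rfl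
  rw [e, e', ← Finset.sum_erase_eq_sub (Finset.mem_univ _)]
  exact Matrix.posSemidef_sum _ fun u _ => qubitTensor_posSemidef fun j => hN j _

theorem sentState_eq (y : Bits (m + m)) : sentState y = ((2 : ℂ) ^ m)⁻¹ • 1 := by
  simp only [sentState, sentQubit_eq]
  rw [qubitTensor_smul, qubitTensor_one]
  simp

end Tensor

/-! ### Instruments -/

section Instruments

variable {O a b : Type} [Fintype O] [Fintype a] [DecidableEq a] [Fintype b]

theorem Instrument.apply_posSemidef (I : Instrument O a b) (o : O) {ρ : Matrix a a ℂ}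
    (hρ : ρ.PosSemidef) : (I.apply o ρ).PosSemidef :=
  Matrix.posSemidef_sum _ fun _ _ => hρ.mul_mul_conjTranspose_same _

theorem Instrument.apply_sub (I : Instrument O a b) (o : O) (ρ σ : Matrix a a ℂ) :
    I.apply o (ρ - σ) = I.apply o ρ - I.apply o σ := by
  simp only [Instrument.apply, Matrix.mul_sub, Matrix.sub_mul, Finset.sum_sub_distrib]

theorem Instrument.trace_sum_apply (I : Instrument O a b) (ρ : Matrix a a ℂ) :
    ∑ o, (I.apply o ρ).trace = ρ.trace := by
  have h : ∀ o k, (I.kraus o k * ρ * (I.kraus o k).conjTranspose).trace =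
      ((I.kraus o k).conjTranspose * I.kraus o k * ρ).trace := by
    intro o k
    rw [Matrix.trace_mul_comm, ← Matrix.mul_assoc]
  simp only [Instrument.apply, Matrix.trace_sum, h]
  simp only [← Matrix.trace_sum, ← Finset.sum_mul]
  rw [I.complete, Matrix.one_mul]

theorem Instrument.trace_apply_unit (I : Channel a b) (ρ : Matrix a a ℂ) :
    (I.apply () ρ).trace = ρ.trace := by
  simpa using I.trace_sum_apply ρ

end Instruments

/-! ### Interactions -/

section Interactions

variable {C R : Type} [Fintype C] [Fintype R]

section Step

variable {a b : Type} [Fintype a] [DecidableEq a] [Fintype b] {answer : C → Matrix R R ℂ}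

theorem sum_apply_kronecker_posSemidef (ask : Instrument C a b)
    (hans : ∀ c, (answer c).PosSemidef) (S : Finset C) {ρ : Matrix a a ℂ} (hρ : ρ.PosSemidef) :
    (∑ c ∈ S, ask.apply c ρ ⊗ₖ answer c).PosSemidef :=
  Matrix.posSemidef_sum _ fun c _ => (ask.apply_posSemidef c hρ).kronecker (hans c)

theorem sum_apply_kronecker_sub_posSemidef (ask : Instrument C a b)
    (hans : ∀ c, (answer c).PosSemidef) {S T : Finset C} (hST : S ⊆ T) {ρ σ : Matrix a a ℂ}
    (hρ : ρ.PosSemidef) (h : (ρ - σ).PosSemidef) :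
    (∑ c ∈ T, ask.apply c ρ ⊗ₖ answer c - ∑ c ∈ S, ask.apply c σ ⊗ₖ answer c).PosSemidef := by
  classical
  rw [← Finset.sum_sdiff hST, add_sub_assoc, ← Finset.sum_sub_distrib]
  refine (sum_apply_kronecker_posSemidef ask hans _ hρ).add
    (Matrix.posSemidef_sum _ fun c _ => ?_)
  have e : ask.apply c ρ ⊗ₖ answer c - ask.apply c σ ⊗ₖ answer c =
      ask.apply c (ρ - σ) ⊗ₖ answer c := by
    rw [ask.apply_sub]
    ext i j
    simp [Matrix.kroneckerMap_apply, sub_mul]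
  rw [e]
  exact (ask.apply_posSemidef c h).kronecker (hans c)

theorem trace_sum_apply_kronecker (ask : Instrument C a b)
    (htr : ∀ c, (answer c).trace = 1) (S : Finset C) (ρ : Matrix a a ℂ) :
    (∑ c ∈ S, ask.apply c ρ ⊗ₖ answer c).trace = ∑ c ∈ S, (ask.apply c ρ).trace := by
  simp [Matrix.trace_sum, Matrix.trace_kronecker, htr]

end Step

variable [DecidableEq R] {answer : C → Matrix R R ℂ}

theorem Interaction.run_posSemidef (hans : ∀ c, (answer c).PosSemidef) (S : Finset C)
    {d e q : ℕ} (I : Interaction C R d e q) {ρ : Matrix (Fin d) (Fin d) ℂ} (hρ : ρ.PosSemidef) :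
    (I.run answer S ρ).PosSemidef := by
  induction I with
  | done => exact hρ
  | query ask absorb rest ih =>
    exact ih (absorb.apply_posSemidef () (sum_apply_kronecker_posSemidef ask hans S hρ))

/-- Allowing more queries only adds positive terms at each step, and instruments preserve the order.
This compares the memory with its restriction to runs that avoid a challenge. -/
theorem Interaction.run_sub_run_posSemidef (hans : ∀ c, (answer c).PosSemidef) {S T : Finset C}
    (hST : S ⊆ T) {d e q : ℕ} (I : Interaction C R d e q) {ρ σ : Matrix (Fin d) (Fin d) ℂ}
    (hρ : ρ.PosSemidef) (h : (ρ - σ).PosSemidef) :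
    (I.run answer T ρ - I.run answer S σ).PosSemidef := by
  induction I with
  | done => exact h
  | query ask absorb rest ih =>
    refine ih (absorb.apply_posSemidef () (sum_apply_kronecker_posSemidef ask hans T hρ)) ?_
    rw [← absorb.apply_sub]
    exact absorb.apply_posSemidef () (sum_apply_kronecker_sub_posSemidef ask hans hST hρ h)

theorem Interaction.trace_run_univ (htr : ∀ c, (answer c).trace = 1)
    {d e q : ℕ} (I : Interaction C R d e q) (ρ : Matrix (Fin d) (Fin d) ℂ) :
    (I.run answer Finset.univ ρ).trace = ρ.trace := by
  induction I with
  | done => rfl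
  | query ask absorb rest ih =>
    rw [Interaction.run, ih, absorb.trace_apply_unit, trace_sum_apply_kronecker ask htr,
      ask.trace_sum_apply]

theorem Interaction.run_congr {answer' : C → Matrix R R ℂ} {S : Finset C}
    (h : ∀ c ∈ S, answer c = answer' c)
    {d e q : ℕ} (I : Interaction C R d e q) (ρ : Matrix (Fin d) (Fin d) ℂ) :
    I.run answer S ρ = I.run answer' S ρ := by
  induction I with
  | done => rfl
  | query ask absorb rest ih =>
    rw [Interaction.run, Interaction.run, ih,
      Finset.sum_congr rfl fun c hc => by rw [h c hc]]

theorem Interaction.run_eq_of_no_queries (answer' : C → Matrix R R ℂ) (S T : Finset C)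
    {d e q : ℕ} (I : Interaction C R d e q) (hq : q = 0) (ρ : Matrix (Fin d) (Fin d) ℂ) :
    I.run answer S ρ = I.run answer' T ρ := by
  cases I with
  | done => rfl
  | query => simp at hq

/-- The union bound: the total trace lost by conditioning an interaction on not querying `c`, summed
over `c`, is at most the number of queries. -/
theorem Interaction.sum_trace_lost_le [DecidableEq C] (hans : ∀ c, (answer c).PosSemidef)
    (htr : ∀ c, (answer c).trace = 1) {d e q : ℕ} (I : Interaction C R d e q)
    {ρ : Matrix (Fin d) (Fin d) ℂ} (hρ : ρ.PosSemidef) (hρ1 : ρ.trace = 1)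
    {σ : C → Matrix (Fin d) (Fin d) ℂ} (hσ : ∀ c, (ρ - σ c).PosSemidef) :
    ∑ c, (1 - ((I.run answer (Finset.univ.erase c) (σ c)).trace).re) ≤
      ∑ c, (1 - ((σ c).trace).re) + q := by
  induction I with
  | done => simp [Interaction.run]
  | @query d d' d'' e q ask absorb rest ih =>
    simp only [Interaction.run]
    refine (ih (absorb.apply_posSemidef () (sum_apply_kronecker_posSemidef ask hans Finset.univ hρ))
      ?_ fun c => ?_).trans ?_
    · rw [absorb.trace_apply_unit, trace_sum_apply_kronecker ask htr, ask.trace_sum_apply, hρ1]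
    · rw [← absorb.apply_sub]
      exact absorb.apply_posSemidef ()
        (sum_apply_kronecker_sub_posSemidef ask hans (Finset.erase_subset _ _) hρ (hσ c))
    -- The trace lost at this step for `c` is exactly the weight of asking `c` now.
    · have h1 : ∀ c, ((absorb.apply () (∑ c' ∈ Finset.univ.erase c,
          ask.apply c' (σ c) ⊗ₖ answer c')).trace).re =
          ((σ c).trace).re - ((ask.apply c (σ c)).trace).re := by
        intro c
        rw [absorb.trace_apply_unit, trace_sum_apply_kronecker ask htr,
          Finset.sum_erase_eq_sub (Finset.mem_univ c), ask.trace_sum_apply, Complex.sub_re]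
      -- The states `σ c` vary with `c`, but all lie below `ρ`, for which the query outcomes form a
      -- single probability distribution.
      have h2 : ∑ c, ((ask.apply c (σ c)).trace).re ≤ 1 := by
        calc _ ≤ ∑ c, ((ask.apply c ρ).trace).re := by
              refine Finset.sum_le_sum fun c _ => ?_
              have := trace_re_nonneg (ask.apply_posSemidef c (hσ c))
              rw [ask.apply_sub, Matrix.trace_sub, Complex.sub_re] at this
              linarith
          _ = 1 := by rw [← Complex.re_sum, ask.trace_sum_apply, hρ1, Complex.one_re]
      simp only [h1, sub_sub_eq_add_sub, add_sub_right_comm, Finset.sum_add_distrib]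
      push_cast
      linarith

end Interactions

/-! ### Answers of the device -/

section Answers

variable {m : ℕ}

theorem single_one_posSemidef {a : Type} [Fintype a] [DecidableEq a] (i : a) :
    (Matrix.single i i (1 : ℂ)).PosSemidef := by
  rw [← Matrix.diagonal_single]
  refine Matrix.PosSemidef.diagonal ?_
  intro j
  by_cases h : j = i
  · subst h; simp
  · simp [h]

theorem crpResponse_posSemidef (y : Bits (m + m)) : (crpResponse y).PosSemidef :=
  single_one_posSemidef _

theorem crpResponse_trace (y : Bits (m + m)) : (crpResponse y).trace = 1 := by
  simp [crpResponse]

theorem qubitProj_trace (c o : Bool) : (qubitProj c o).trace = 1 := by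
  cases c <;> cases o <;>
    simp only [qubitProj_false, qubitProj_true, realSym_trace] <;> norm_num

theorem measuredQubit_posSemidef (c e b : Bool) : (measuredQubit c e b).PosSemidef := by
  rw [measuredQubit_eq]
  refine (qubitProj_posSemidef _ _).smul ?_
  exact_mod_cast (by norm_num : (0 : ℝ) ≤ 1 / 2)

theorem sessionResponse_posSemidef (y : Bits (m + m)) : (sessionResponse y).PosSemidef :=
  Matrix.posSemidef_sum _ fun b _ =>
    (qubitTensor_posSemidef fun _ => measuredQubit_posSemidef _ _ _).kronecker
      (single_one_posSemidef b)

theorem sessionResponse_trace (y : Bits (m + m)) : (sessionResponse y).trace = 1 := by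
  simp only [sessionResponse, Matrix.trace_sum, Matrix.trace_kronecker, qubitTensor_trace,
    measuredQubit_eq, Matrix.trace_smul, qubitProj_trace, Matrix.trace_single_eq_same]
  simp

theorem sentState_posSemidef (y : Bits (m + m)) : (sentState y).PosSemidef := by
  rw [sentState_eq]
  refine Matrix.PosSemidef.one.smul ?_
  have : ((2 : ℂ) ^ m)⁻¹ = ((((2 : ℝ) ^ m)⁻¹ : ℝ) : ℂ) := by push_cast; rfl
  rw [this]
  exact_mod_cast (by positivity : (0 : ℝ) ≤ ((2 : ℝ) ^ m)⁻¹)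

theorem sentState_trace (y : Bits (m + m)) : (sentState y).trace = 1 := by
  rw [sentState_eq, Matrix.trace_smul, Matrix.trace_one]
  simp

end Answers

/-! ### The acceptance operator -/

section Accept

variable {m : ℕ}

/-- Once `y` and `b` are fixed, exactly one outcome string is accepted. -/
theorem acceptOp_eq (y : Bits (m + m)) (b : Bits m) :
    acceptOp y b = qubitTensor fun j => qubitProj (basisPart y j) (encodedPart y j ^^ b j) := by
  have h : (Finset.univ.filter fun a : Bits m => ∀ j, (a j ^^ b j) = encodedPart y j) =
      {fun j => encodedPart y j ^^ b j} := by
    ext a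
    simp only [Finset.mem_filter, Finset.mem_univ, true_and, Finset.mem_singleton, funext_iff]
    refine forall_congr' fun j => ?_
    cases a j <;> cases b j <;> cases encodedPart y j <;> simp
  rw [acceptOp, h, Finset.sum_singleton]

theorem acceptOp_posSemidef (y : Bits (m + m)) (b : Bits m) : (acceptOp y b).PosSemidef := by
  rw [acceptOp_eq]
  exact qubitTensor_posSemidef fun _ => qubitProj_posSemidef _ _

theorem one_sub_qubitProj_posSemidef (c o : Bool) : (1 - qubitProj c o).PosSemidef := by
  rw [← qubitProj_sum c, ← Finset.sum_erase_eq_sub (Finset.mem_univ o)]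
  exact Matrix.posSemidef_sum _ fun _ _ => qubitProj_posSemidef _ _

theorem one_sub_acceptOp_posSemidef (y : Bits (m + m)) (b : Bits m) :
    (((1 : ℝ) : ℂ) • (1 : Matrix (Bits m) (Bits m) ℂ) - acceptOp y b).PosSemidef := by
  rw [acceptOp_eq]
  have := smul_one_sub_qubitTensor_posSemidef (m := m) (k := 1)
    (M := fun j => qubitProj (basisPart y j) (encodedPart y j ^^ b j))
    (fun _ => qubitProj_posSemidef _ _)
    (fun _ => by simpa using one_sub_qubitProj_posSemidef _ _)
  simpa using this

/-- The probability of the response `y` of a device of bias `δ`. -/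
noncomputable def responseProb (δ : ℝ) {l : ℕ} (y : Bits l) : ℝ := ∏ j, bitProb δ (y j)

theorem responseProb_nonneg {δ : ℝ} (h₀ : 0 ≤ δ) (h₁ : δ ≤ 1 / 2) {l : ℕ} (y : Bits l) :
    0 ≤ responseProb δ y :=
  Finset.prod_nonneg fun _ _ => bitProb_nonneg h₀ h₁ _

theorem responseProb_sum (δ : ℝ) (l : ℕ) : ∑ y : Bits l, responseProb δ y = 1 := by
  simp only [responseProb]
  rw [← Fintype.prod_sum (fun (_ : Fin l) b => bitProb δ b)]
  simp only [bitProb_sum, Finset.prod_const_one]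

theorem sum_responseProb_smul_acceptOp (δ : ℝ) (b : Bits m) :
    ∑ y : Bits (m + m), (responseProb δ y : ℂ) • acceptOp y b =
      qubitTensor fun j => averageProj δ (b j) := by
  have h : ∀ j, averageProj δ (b j) = ∑ t : Bool × Bool,
      ((bitProb δ t.1 * bitProb δ t.2 : ℝ) : ℂ) • qubitProj t.1 (t.2 ^^ b j) := by
    intro j; rw [averageProj, Fintype.sum_prod_type]
  rw [funext h, qubitTensor_sum]
  -- A response of `2m` bits is read as `m` pairs (basis bit, encoded bit), one for each qubit.
  refine Fintype.sum_equiv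
    ((Fin.appendEquiv m m).symm.trans (Equiv.arrowProdEquivProdArrow _ _ _).symm) _ _ fun y => ?_
  have e : ∀ j, ((Fin.appendEquiv m m).symm.trans
      (Equiv.arrowProdEquivProdArrow (Fin m) (fun _ => Bool) (fun _ => Bool)).symm) y j =
      (basisPart y j, encodedPart y j) := fun j => rfl
  simp only [e]
  rw [qubitTensor_smul, ← acceptOp_eq, responseProb, Fin.prod_univ_add, ← Finset.prod_mul_distrib]
  simp [basisPart, encodedPart]

end Accept

section Protocol

variable {n m : ℕ}

/-! ### Expectations over the device and the database -/

/-- The probability of the challenge-response table `g` of a device of bias `δ`. -/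
noncomputable def biasedTableProb (δ : ℝ) {n l : ℕ} (g : Bits n → Bits l) : ℝ :=
  ∏ x, responseProb δ (g x)

theorem biasedTableProb_nonneg {δ : ℝ} (h₀ : 0 ≤ δ) (h₁ : δ ≤ 1 / 2) {l : ℕ}
    (g : Bits n → Bits l) : 0 ≤ biasedTableProb δ g :=
  Finset.prod_nonneg fun _ _ => responseProb_nonneg h₀ h₁ _

theorem biasedTableProb_sum (δ : ℝ) (n l : ℕ) :
    ∑ g : Bits n → Bits l, biasedTableProb δ g = 1 := by
  simp only [biasedTableProb]
  rw [← Fintype.prod_sum (fun (_ : Bits n) y => responseProb δ (l := l) y)]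
  simp only [responseProb_sum, Finset.prod_const_one]

/-- Each database entry is uniform on its own, so its size drops out; the other `d - 1` entries
contribute `2 ^ n` each to the count. -/
theorem database_average {d : ℕ} (hd : 0 < d) (f : Bits n → ℝ) :
    (∑ D : Fin d → Bits n, (∑ i, f (D i)) / (d : ℝ)) / (Fintype.card (Fin d → Bits n) : ℝ) =
      (∑ x, f x) / 2 ^ n := by
  have h1 : ∀ i : Fin d, ∑ D : Fin d → Bits n, f (D i) = ((2 : ℝ) ^ n) ^ (d - 1) * ∑ x, f x := by
    intro i
    have := Fintype.sum_piFinset_apply f Finset.univ i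
    rw [Fintype.piFinset_univ] at this
    rw [this]
    simp
  have hd' : (d : ℝ) ≠ 0 := by exact_mod_cast hd.ne'
  rw [← Finset.sum_div, Finset.sum_comm, Finset.sum_congr rfl fun i _ => h1 i]
  obtain ⟨k, rfl⟩ : ∃ k, d = k + 1 := ⟨d - 1, by omega⟩
  simp only [Finset.sum_const, Finset.card_univ, Fintype.card_fin, nsmul_eq_mul,
    Fintype.card_pi, Fintype.card_bool, Finset.prod_const, Nat.cast_pow, Nat.cast_ofNat,
    Nat.add_sub_cancel]
  field_simp
  ring

theorem expectation_eq {δ : ℝ} {P : ClassicalPUF n (m + m)} (hP : P.HasBias δ) {d : ℕ}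
    (hd : 0 < d) (F : (Bits n → Bits (m + m)) → Bits n → ℝ) :
    expectation P d F = ∑ g, biasedTableProb δ g * ((∑ x, F g x) / 2 ^ n) := by
  rw [expectation]
  refine Finset.sum_congr rfl fun g _ => ?_
  rw [database_average hd, hP g]
  rfl

theorem expectation_mono {δ : ℝ} (h₀ : 0 ≤ δ) (h₁ : δ ≤ 1 / 2) {P : ClassicalPUF n (m + m)}
    (hP : P.HasBias δ) {d : ℕ} (hd : 0 < d) {F G : (Bits n → Bits (m + m)) → Bits n → ℝ}
    (h : ∀ g, ∑ x, F g x ≤ ∑ x, G g x) : expectation P d F ≤ expectation P d G := by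
  rw [expectation_eq hP hd, expectation_eq hP hd]
  refine Finset.sum_le_sum fun g _ => mul_le_mul_of_nonneg_left ?_ (biasedTableProb_nonneg h₀ h₁ g)
  exact div_le_div_of_nonneg_right (h g) (by positivity)

theorem expectation_eq_sum_challenges {δ : ℝ} {P : ClassicalPUF n (m + m)} (hP : P.HasBias δ)
    {d : ℕ} (hd : 0 < d) (F : (Bits n → Bits (m + m)) → Bits n → ℝ) :
    expectation P d F = (∑ x, ∑ g, biasedTableProb δ g * F g x) / 2 ^ n := by
  rw [expectation_eq hP hd, Finset.sum_comm, Finset.sum_div]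
  refine Finset.sum_congr rfl fun g _ => ?_
  rw [← Finset.mul_sum, mul_div_assoc]

/-- Stated without division because `responseProb` can vanish when `δ = 1/2`. -/
theorem biasedTableProb_update (δ : ℝ) {l : ℕ} (g : Bits n → Bits l) (x : Bits n) (y : Bits l) :
    biasedTableProb δ (Function.update g x y) * responseProb δ (g x) =
      biasedTableProb δ g * responseProb δ y := by
  simp only [biasedTableProb]
  rw [← Finset.mul_prod_erase _ _ (Finset.mem_univ x),
    ← Finset.mul_prod_erase _ (fun x => responseProb δ (g x)) (Finset.mem_univ x),
    Function.update_self]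
  have : ∏ z ∈ Finset.univ.erase x, responseProb δ (Function.update g x y z) =
      ∏ z ∈ Finset.univ.erase x, responseProb δ (g z) :=
    Finset.prod_congr rfl fun z hz => by rw [Function.update_of_ne (Finset.ne_of_mem_erase hz)]
  rw [this]
  ring

/-- The response to `x` is independent of the rest of the table. -/
theorem sum_biasedTableProb_resample (δ : ℝ) {l : ℕ} (x : Bits n)
    (H : (Bits n → Bits l) → Bits l → ℝ)
    (hH : ∀ g y y', H (Function.update g x y') y = H g y) :
    ∑ g, biasedTableProb δ g * H g (g x) =
      ∑ g, biasedTableProb δ g * ∑ y, responseProb δ y * H g y := by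
  have e : ∑ g, biasedTableProb δ g * H g (g x) =
      ∑ p : (Bits n → Bits l) × Bits l,
        biasedTableProb δ p.1 * responseProb δ p.2 * H p.1 (p.1 x) := by
    rw [Fintype.sum_prod_type]
    refine Finset.sum_congr rfl fun g _ => ?_
    simp only [mul_assoc, ← Finset.mul_sum]
    rw [← Finset.sum_mul, responseProb_sum, one_mul]
  have e' : ∑ g, biasedTableProb δ g * ∑ y, responseProb δ y * H g y =
      ∑ p : (Bits n → Bits l) × Bits l,
        biasedTableProb δ p.1 * responseProb δ p.2 * H p.1 p.2 := by
    rw [Fintype.sum_prod_type]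
    refine Finset.sum_congr rfl fun g _ => ?_
    simp only [mul_assoc, ← Finset.mul_sum]
  rw [e, e']
  -- Exchanging `g x` with an independent fresh response `y` preserves the joint weight, and `hH`
  -- makes `H` blind to the exchange.
  have hinv : Function.Involutive
      fun p : (Bits n → Bits l) × Bits l => (Function.update p.1 x p.2, p.1 x) := by
    rintro ⟨g, y⟩
    simp
  refine Fintype.sum_equiv hinv.toPerm _ _ ?_
  rintro ⟨g, y⟩
  simp only [Function.Involutive.coe_toPerm]
  rw [biasedTableProb_update, hH]

/-! ### Forgeries -/

section Forgery

variable (A : Adversary n m) (g : Bits n → Bits (m + m)) (x : Bits n)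

theorem Adversary.memory_posSemidef (S : Finset (Bits n)) : (A.memory g S).PosSemidef :=
  A.sessions.run_posSemidef (fun _ => sessionResponse_posSemidef _) S
    (A.setup.run_posSemidef (fun _ => crpResponse_posSemidef _) S A.start_density.1)

theorem Adversary.memory_univ_trace : (A.memory g Finset.univ).trace = 1 := by
  rw [Adversary.memory, Interaction.trace_run_univ fun _ => sessionResponse_trace _,
    Interaction.trace_run_univ fun _ => crpResponse_trace _, A.start_density.2]

theorem Adversary.memory_sub_posSemidef (S : Finset (Bits n)) :
    (A.memory g Finset.univ - A.memory g S).PosSemidef := by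
  refine Interaction.run_sub_run_posSemidef (fun _ => sessionResponse_posSemidef _)
    (Finset.subset_univ _) _
    (A.setup.run_posSemidef (fun _ => crpResponse_posSemidef _) _ A.start_density.1) ?_
  refine Interaction.run_sub_run_posSemidef (fun _ => crpResponse_posSemidef _)
    (Finset.subset_univ _) _ A.start_density.1 ?_
  rw [sub_self]
  exact Matrix.PosSemidef.zero

theorem Adversary.memory_update (y : Bits (m + m)) :
    A.memory (Function.update g x y) (Finset.univ.erase x) =
      A.memory g (Finset.univ.erase x) := by
  have h : ∀ z ∈ Finset.univ.erase x, Function.update g x y z = g z := fun z hz =>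
    Function.update_of_ne (Finset.ne_of_mem_erase hz) _ _
  rw [Adversary.memory, Adversary.memory,
    Interaction.run_congr (fun z hz => by rw [h z hz]) A.setup A.start]
  exact Interaction.run_congr (fun z hz => by rw [h z hz]) _ _

theorem Adversary.memory_eq_of_no_queries (hA : A.queries = 0) (S T : Finset (Bits n)) :
    A.memory g S = A.memory g T := by
  have h : A.setupQueries = 0 ∧ A.sessionQueries = 0 := by
    simpa [Adversary.queries] using hA
  rw [Adversary.memory, Adversary.memory,
    Interaction.run_eq_of_no_queries (fun x => crpResponse (g x)) S T A.setup h.1]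
  exact Interaction.run_eq_of_no_queries _ _ _ _ h.2 _

/-- The union bound is applied to each phase; the restricted states left by the setup enter the
sessions as `σ`, so the losses add up. -/
theorem Adversary.sum_trace_memory_lost_le :
    ∑ x, (1 - ((A.memory g (Finset.univ.erase x)).trace).re) ≤ A.queries := by
  have h1 := A.setup.sum_trace_lost_le (answer := fun x => crpResponse (g x))
    (fun _ => crpResponse_posSemidef _)
    (fun _ => crpResponse_trace _) A.start_density.1 A.start_density.2 (σ := fun _ => A.start)
    (fun _ => by rw [sub_self]; exact Matrix.PosSemidef.zero)
  have h2 := A.sessions.sum_trace_lost_le (answer := fun x => sessionResponse (g x))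
    (fun _ => sessionResponse_posSemidef _)
    (fun _ => sessionResponse_trace _)
    (A.setup.run_posSemidef (answer := fun x => crpResponse (g x))
      (fun _ => crpResponse_posSemidef _) Finset.univ A.start_density.1)
    (by rw [Interaction.trace_run_univ fun _ => crpResponse_trace _, A.start_density.2])
    (σ := fun x => A.setup.run (fun x => crpResponse (g x)) (Finset.univ.erase x) A.start)
    (fun x => Interaction.run_sub_run_posSemidef (fun _ => crpResponse_posSemidef _)
      (Finset.subset_univ _) _ A.start_density.1 (by rw [sub_self]; exact Matrix.PosSemidef.zero))
  refine h2.trans ?_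
  simp only [A.start_density.2, Complex.one_re, sub_self, Finset.sum_const_zero, zero_add] at h1
  rw [Adversary.queries]
  push_cast
  linarith

theorem Adversary.forgery_posSemidef {ρ : Matrix (Fin A.dim₂) (Fin A.dim₂) ℂ}
    (hρ : ρ.PosSemidef) (b : Bits m) : (A.forgery g x ρ b).PosSemidef :=
  (A.forge x).apply_posSemidef b ((A.late x).run_posSemidef
    (fun _ => sessionResponse_posSemidef _) _
    ((A.intercept x).apply_posSemidef () (hρ.kronecker (sentState_posSemidef _))))

theorem Adversary.forgery_sub_posSemidef {ρ σ : Matrix (Fin A.dim₂) (Fin A.dim₂) ℂ}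
    (hρ : ρ.PosSemidef) (h : (ρ - σ).PosSemidef) (b : Bits m) :
    (A.forgery g x ρ b - A.forgery g x σ b).PosSemidef := by
  rw [Adversary.forgery, Adversary.forgery, ← Instrument.apply_sub]
  refine (A.forge x).apply_posSemidef b (Interaction.run_sub_run_posSemidef
    (fun _ => sessionResponse_posSemidef _) subset_rfl _
    ((A.intercept x).apply_posSemidef () (hρ.kronecker (sentState_posSemidef _))) ?_)
  rw [← Instrument.apply_sub]
  have e : ρ ⊗ₖ sentState (g x) - σ ⊗ₖ sentState (g x) = (ρ - σ) ⊗ₖ sentState (g x) := by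
    ext i j
    simp [Matrix.kroneckerMap_apply, sub_mul]
  rw [e]
  exact (A.intercept x).apply_posSemidef () (h.kronecker (sentState_posSemidef _))

theorem Adversary.forgery_trace (ρ : Matrix (Fin A.dim₂) (Fin A.dim₂) ℂ) :
    ∑ b, (A.forgery g x ρ b).trace = ρ.trace := by
  simp only [Adversary.forgery]
  rw [Instrument.trace_sum_apply, Interaction.trace_run_univ fun _ => sessionResponse_trace _,
    Instrument.trace_apply_unit, Matrix.trace_kronecker, sentState_trace, mul_one]

/-- The response to `x` could enter only through the seized qubits, which are maximally mixed, or
the late sessions, whose queries exclude `x` by type. -/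
theorem Adversary.forgery_update (y : Bits (m + m)) (ρ : Matrix (Fin A.dim₂) (Fin A.dim₂) ℂ)
    (b : Bits m) : A.forgery (Function.update g x y) x ρ b = A.forgery g x ρ b := by
  have h : ∀ z : {x' : Bits n // x' ≠ x}, Function.update g x y z.1 = g z.1 := fun z =>
    Function.update_of_ne z.2 _ _
  simp only [Adversary.forgery, h, sentState_eq]

theorem Adversary.acceptOn_nonneg (S : Finset (Bits n)) : 0 ≤ A.acceptOn g x S := by
  rw [Adversary.acceptOn, Complex.re_sum]
  exact Finset.sum_nonneg fun b _ => trace_mul_re_nonneg (acceptOp_posSemidef _ _)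
    (A.forgery_posSemidef g x (A.memory_posSemidef g S) b)

/-- The acceptance operator is at most `1`, so the discarded positive part of the memory contributes
no more than its trace. -/
theorem Adversary.acceptOn_univ_le :
    A.acceptOn g x Finset.univ ≤ A.acceptOn g x (Finset.univ.erase x) +
      (1 - ((A.memory g (Finset.univ.erase x)).trace).re) := by
  have h : ∀ b, ((acceptOp (g x) b * A.forgery g x (A.memory g Finset.univ) b).trace).re -
      ((acceptOp (g x) b * A.forgery g x (A.memory g (Finset.univ.erase x)) b).trace).re ≤
      ((A.forgery g x (A.memory g Finset.univ) b).trace).re -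
      ((A.forgery g x (A.memory g (Finset.univ.erase x)) b).trace).re := by
    intro b
    have := trace_mul_re_le (one_sub_acceptOp_posSemidef (g x) b)
      (A.forgery_sub_posSemidef g x (A.memory_posSemidef g _)
        (A.memory_sub_posSemidef g (Finset.univ.erase x)) b)
    simpa only [Matrix.mul_sub, Matrix.trace_sub, Complex.sub_re, one_mul] using this
  have h' := Finset.sum_le_sum fun b (_ : b ∈ Finset.univ) => h b
  simp only [Finset.sum_sub_distrib, ← Complex.re_sum] at h'
  rw [A.forgery_trace, A.forgery_trace, A.memory_univ_trace, Complex.one_re] at h'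
  simp only [Adversary.acceptOn]
  linarith

/-- Averaging over the response to a challenge that was not used before. -/
theorem Adversary.sum_acceptOn_fresh (δ : ℝ) :
    ∑ g, biasedTableProb δ g * A.acceptOn g x (Finset.univ.erase x) =
      ∑ g, biasedTableProb δ g * ∑ b : Bits m, (((qubitTensor fun j => averageProj δ (b j)) *
        A.forgery g x (A.memory g (Finset.univ.erase x)) b).trace).re := by
  have h := sum_biasedTableProb_resample δ x (fun g y => ∑ b : Bits m,
    ((acceptOp y b * A.forgery g x (A.memory g (Finset.univ.erase x)) b).trace).re) (by
      intro g y y'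
      simp only [A.memory_update, A.forgery_update])
  simp only [Adversary.acceptOn, Complex.re_sum]
  rw [h]
  refine Finset.sum_congr rfl fun g _ => ?_
  congr 1
  simp only [Finset.mul_sum]
  rw [Finset.sum_comm]
  refine Finset.sum_congr rfl fun b _ => ?_
  rw [← sum_responseProb_smul_acceptOp, Finset.sum_mul, Matrix.trace_sum, Complex.re_sum]
  refine Finset.sum_congr rfl fun y _ => ?_
  rw [Matrix.smul_mul, Matrix.trace_smul, smul_eq_mul, Complex.re_ofReal_mul]

end Forgery

/-! ### Bounds on the acceptance probability -/

theorem sum_trace_averageProj_mul_le {δ : ℝ} (h₀ : 0 ≤ δ) (h₁ : δ ≤ 1 / 2)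
    {σ : Bits m → Matrix (Bits m) (Bits m) ℂ} (hσ : ∀ b, (σ b).PosSemidef) :
    ∑ b : Bits m, (((qubitTensor fun j => averageProj δ (b j)) * σ b).trace).re ≤
      forgeValue δ ^ m * (∑ b, (σ b).trace).re := by
  rw [Complex.re_sum, Finset.mul_sum]
  refine Finset.sum_le_sum fun b _ => trace_mul_re_le ?_ (hσ b)
  exact smul_one_sub_qubitTensor_posSemidef (fun _ => averageProj_posSemidef h₀ h₁ _)
    fun _ => forgeValue_sub_averageProj_posSemidef h₀ _

theorem freshAcceptProb_le {δ : ℝ} (h₀ : 0 ≤ δ) (h₁ : δ ≤ 1 / 2) {P : ClassicalPUF n (m + m)}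
    (hP : P.HasBias δ) {d : ℕ} (hd : 0 < d) (A : Adversary n m) :
    freshAcceptProb P d A ≤ forgeValue δ ^ m * freshProb P d A := by
  rw [freshAcceptProb, freshProb, expectation_eq_sum_challenges hP hd,
    expectation_eq_sum_challenges hP hd, ← mul_div_assoc, Finset.mul_sum]
  refine div_le_div_of_nonneg_right (Finset.sum_le_sum fun x _ => ?_) (by positivity)
  rw [A.sum_acceptOn_fresh, Finset.mul_sum]
  refine Finset.sum_le_sum fun g _ => ?_
  rw [mul_left_comm]
  refine mul_le_mul_of_nonneg_left ?_ (biasedTableProb_nonneg h₀ h₁ g)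
  have := sum_trace_averageProj_mul_le h₀ h₁ fun b =>
    A.forgery_posSemidef g x (A.memory_posSemidef g (Finset.univ.erase x)) b
  rwa [A.forgery_trace] at this

theorem forgeValue_nonneg {δ : ℝ} (h₀ : 0 ≤ δ) : 0 ≤ forgeValue δ := by
  unfold forgeValue; positivity

theorem freshProb_le_one {δ : ℝ} (h₀ : 0 ≤ δ) (h₁ : δ ≤ 1 / 2) {P : ClassicalPUF n (m + m)}
    (hP : P.HasBias δ) {d : ℕ} (hd : 0 < d) (A : Adversary n m) : freshProb P d A ≤ 1 := by
  have h : freshProb P d A ≤ expectation P d fun _ _ => 1 := by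
    refine expectation_mono h₀ h₁ hP hd fun g => Finset.sum_le_sum fun x _ => ?_
    have := trace_re_nonneg (A.memory_sub_posSemidef g (Finset.univ.erase x))
    rw [Matrix.trace_sub, A.memory_univ_trace, Complex.sub_re, Complex.one_re] at this
    linarith
  refine h.trans_eq ?_
  rw [expectation_eq hP hd]
  simp [biasedTableProb_sum]

theorem acceptProb_le {δ : ℝ} (h₀ : 0 ≤ δ) (h₁ : δ ≤ 1 / 2) {P : ClassicalPUF n (m + m)}
    (hP : P.HasBias δ) {d : ℕ} (hd : 0 < d) (A : Adversary n m) :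
    acceptProb P d A ≤ forgeValue δ ^ m + (A.queries : ℝ) / 2 ^ n := by
  have h : acceptProb P d A ≤ freshAcceptProb P d A + (A.queries : ℝ) / 2 ^ n := by
    rw [acceptProb, freshAcceptProb, expectation_eq hP hd, expectation_eq hP hd]
    have e : (A.queries : ℝ) / 2 ^ n = ∑ g : Bits n → Bits (m + m),
        biasedTableProb δ g * ((A.queries : ℝ) / 2 ^ n) := by
      rw [← Finset.sum_mul, biasedTableProb_sum, one_mul]
    rw [e, ← Finset.sum_add_distrib]
    refine Finset.sum_le_sum fun g _ => ?_
    rw [← mul_add, ← add_div]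
    refine mul_le_mul_of_nonneg_left ?_ (biasedTableProb_nonneg h₀ h₁ g)
    refine div_le_div_of_nonneg_right ?_ (by positivity)
    have h1 := Finset.sum_le_sum fun x (_ : x ∈ Finset.univ) => A.acceptOn_univ_le g x
    rw [Finset.sum_add_distrib] at h1
    linarith [A.sum_trace_memory_lost_le g]
  have h2 := freshAcceptProb_le h₀ h₁ hP hd A
  have h3 := mul_le_mul_of_nonneg_left (freshProb_le_one h₀ h₁ hP hd A)
    (pow_nonneg (forgeValue_nonneg h₀) m)
  linarith

theorem acceptProb_nonneg {δ : ℝ} (h₀ : 0 ≤ δ) (h₁ : δ ≤ 1 / 2) {P : ClassicalPUF n (m + m)}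
    (hP : P.HasBias δ) {d : ℕ} (hd : 0 < d) (A : Adversary n m) : 0 ≤ acceptProb P d A := by
  rw [acceptProb, expectation_eq hP hd]
  refine Finset.sum_nonneg fun g _ => mul_nonneg (biasedTableProb_nonneg h₀ h₁ g) ?_
  exact div_nonneg (Finset.sum_nonneg fun x _ => A.acceptOn_nonneg g x _) (by positivity)

/-! ### Adversaries without queries -/

section Prepare

variable {O a : Type} [Fintype O] [Fintype a]

/-- The instrument that discards its input and prepares the qubits in one of the states
`(B o)ᴴ * B o`, announcing `o`. -/
noncomputable def prepare (B : O → Matrix a a ℂ)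
    (h : ∑ o, ((B o).conjTranspose * B o).trace = 1) : Instrument O (Fin 1) a where
  num := Fintype.card a
  -- One Kraus operator for each row of `B o`: the adjoint of that row, as a column. Their rank one
  -- products add up to `(B o)ᴴ * B o`.
  kraus o k := Matrix.of fun s _ => star (B o ((Fintype.equivFin a).symm k) s)
  complete := by
    ext i j
    obtain rfl := Subsingleton.elim i j
    rw [Matrix.one_apply_eq, ← h, Matrix.sum_apply]
    refine Finset.sum_congr rfl fun o _ => ?_
    rw [Matrix.sum_apply, ← (Fintype.equivFin a).sum_comp]
    simp only [Matrix.mul_apply, Matrix.conjTranspose_apply, Matrix.of_apply,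
      Equiv.symm_apply_apply, star_star, Matrix.trace, Matrix.diag_apply]
    rw [Finset.sum_comm]
    exact Finset.sum_congr rfl fun _ _ => Finset.sum_congr rfl fun _ _ => mul_comm _ _

theorem prepare_apply (B : O → Matrix a a ℂ)
    (h : ∑ o, ((B o).conjTranspose * B o).trace = 1) (o : O) (ρ : Matrix (Fin 1) (Fin 1) ℂ) :
    (prepare B h).apply o ρ = ρ.trace • ((B o).conjTranspose * B o) := by
  have e : (prepare B h).apply o ρ = ∑ k : Fin (Fintype.card a),
      (Matrix.of fun s (_ : Fin 1) => star (B o ((Fintype.equivFin a).symm k) s)) * ρ *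
        (Matrix.of fun s (_ : Fin 1) => star (B o ((Fintype.equivFin a).symm k) s)).conjTranspose :=
    rfl
  rw [e]
  ext s t
  rw [Matrix.sum_apply, ← (Fintype.equivFin a).sum_comp]
  simp only [Matrix.mul_apply, Matrix.conjTranspose_apply, Matrix.of_apply, Equiv.symm_apply_apply,
    star_star, Fin.sum_univ_one, Matrix.smul_apply, smul_eq_mul, Finset.mul_sum, Matrix.trace_fin_one]
  exact Finset.sum_congr rfl fun _ _ => by ring

/-- The channel that discards its input. -/
noncomputable def discard (a : Type) [Fintype a] [DecidableEq a] : Channel a (Fin 1) where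
  num := Fintype.card a
  kraus _ k := Matrix.of fun _ s => if s = (Fintype.equivFin a).symm k then 1 else 0
  complete := by
    ext i j
    rw [Fintype.sum_unique, Matrix.sum_apply, ← (Fintype.equivFin a).sum_comp]
    simp [Matrix.mul_apply, Matrix.one_apply]

end Prepare

/-- The adversary that makes no queries and sends the string `b` with the qubits in the unnormalised
state `(B b)ᴴ * B b`. -/
noncomputable def preparingAdversary (n : ℕ) (B : Bits m → Matrix (Bits m) (Bits m) ℂ)
    (h : ∑ b, ((B b).conjTranspose * B b).trace = 1) : Adversary n m where
  dim₀ := 1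
  dim₁ := 1
  dim₂ := 1
  start := 1
  start_density := ⟨Matrix.PosSemidef.one, by simp⟩
  setupQueries := 0
  setup := .done 1
  sessionQueries := 0
  sessions := .done 1
  dim₃ _ := 1
  dim₄ _ := 1
  intercept _ := discard _
  lateQueries _ := 0
  late _ := .done 1
  forge _ := prepare B h

theorem preparingAdversary_forgery (B : Bits m → Matrix (Bits m) (Bits m) ℂ)
    (h : ∑ b, ((B b).conjTranspose * B b).trace = 1) (g : Bits n → Bits (m + m)) (x : Bits n)
    (S : Finset (Bits n)) (b : Bits m) :
    (preparingAdversary n B h).forgery g x ((preparingAdversary n B h).memory g S) b =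
      (B b).conjTranspose * B b := by
  have e : (preparingAdversary n B h).forgery g x ((preparingAdversary n B h).memory g S) b =
      (prepare B h).apply b ((discard _).apply ()
        ((1 : Matrix (Fin 1) (Fin 1) ℂ) ⊗ₖ sentState (g x))) := rfl
  rw [e, prepare_apply, Instrument.trace_apply_unit, Matrix.trace_kronecker, sentState_trace]
  simp

/-- Without queries, an adversary can do no better than sending fixed states. -/
theorem acceptProbs_without_queries {δ : ℝ} (h₀ : 0 ≤ δ) (h₁ : δ ≤ 1 / 2)
    {P : ClassicalPUF n (m + m)} (hP : P.HasBias δ) {d : ℕ} (hd : 0 < d) :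
    {p : ℝ | ∃ A : Adversary n m, A.queries = 0 ∧ acceptProb P d A = p} =
      {p : ℝ | ∃ σ : Bits m → Matrix (Bits m) (Bits m) ℂ, (∀ b, (σ b).PosSemidef) ∧
        ∑ b, (σ b).trace = 1 ∧
        ∑ b : Bits m, (((qubitTensor fun j => averageProj δ (b j)) * σ b).trace).re = p} := by
  -- With no queries the memory does not depend on the allowed set, so every challenge counts as
  -- fresh.
  have key : ∀ A : Adversary n m, A.queries = 0 → acceptProb P d A =
      (∑ x, ∑ g, biasedTableProb δ g * ∑ b : Bits m,
        (((qubitTensor fun j => averageProj δ (b j)) *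
          A.forgery g x (A.memory g Finset.univ) b).trace).re) / 2 ^ n := by
    intro A hA
    rw [acceptProb, expectation_eq_sum_challenges hP hd]
    congr 1
    refine Finset.sum_congr rfl fun x _ => ?_
    have := A.sum_acceptOn_fresh x δ
    simpa only [Adversary.acceptOn,
      fun g => A.memory_eq_of_no_queries g hA (Finset.univ.erase x) Finset.univ] using this
  ext p
  constructor
  · rintro ⟨A, hA, rfl⟩
    -- The functional no longer depends on `g` or `x`, so the forgeries can be replaced by their
    -- average over both.
    refine ⟨fun b => ∑ x, ∑ g, ((biasedTableProb δ g / 2 ^ n : ℝ) : ℂ) •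
      A.forgery g x (A.memory g Finset.univ) b, fun b => ?_, ?_, ?_⟩
    · refine Matrix.posSemidef_sum _ fun x _ => Matrix.posSemidef_sum _ fun g _ =>
        (A.forgery_posSemidef g x (A.memory_posSemidef g _) b).smul ?_
      exact_mod_cast div_nonneg (biasedTableProb_nonneg h₀ h₁ g) (by positivity)
    · simp only [Matrix.trace_sum, Matrix.trace_smul]
      rw [Finset.sum_comm, Finset.sum_congr rfl fun x _ => Finset.sum_comm]
      simp only [← Finset.smul_sum, A.forgery_trace, A.memory_univ_trace]
      simp only [smul_eq_mul, mul_one]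
      rw [← Complex.ofReal_sum, ← Finset.sum_div, biasedTableProb_sum]
      simp
    · rw [key A hA]
      simp only [Finset.mul_sum, Matrix.mul_smul, Matrix.trace_sum, Matrix.trace_smul,
        smul_eq_mul, Complex.re_sum, Complex.re_ofReal_mul]
      rw [Finset.sum_comm, Finset.sum_div]
      refine Finset.sum_congr rfl fun x _ => ?_
      rw [Finset.sum_comm, Finset.sum_div]
      refine Finset.sum_congr rfl fun g _ => ?_
      rw [Finset.sum_div]
      exact Finset.sum_congr rfl fun b _ => by ring
  · rintro ⟨σ, hσ, htr, rfl⟩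
    choose B hB using fun b => exists_conjTranspose_mul_self (hσ b)
    have htr' : ∑ b, ((B b).conjTranspose * B b).trace = 1 := by
      simpa only [← hB] using htr
    refine ⟨preparingAdversary n B htr', rfl, ?_⟩
    rw [key _ rfl]
    simp only [preparingAdversary_forgery, ← hB]
    simp only [← Finset.sum_mul, biasedTableProb_sum, one_mul]
    simp

theorem isGreatest_acceptProb_without_queries {δ : ℝ} (h₀ : 0 ≤ δ) (h₁ : δ ≤ 1 / 2)
    {P : ClassicalPUF n (m + m)} (hP : P.HasBias δ) {d : ℕ} (hd : 0 < d) :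
    IsGreatest {p : ℝ | ∃ A : Adversary n m, A.queries = 0 ∧ acceptProb P d A = p}
      (forgeValue δ ^ m) := by
  rw [acceptProbs_without_queries h₀ h₁ hP hd]
  constructor
  · refine ⟨fun b => if b = fun _ => false then qubitTensor fun _ => optimalQubit δ else 0,
      fun b => ?_, ?_, ?_⟩
    · dsimp only
      split_ifs
      · exact qubitTensor_posSemidef fun _ => (optimalQubit_density h₀).1
      · exact Matrix.PosSemidef.zero
    · rw [Finset.sum_eq_single (fun _ => false)]
      · simp [qubitTensor_trace, (optimalQubit_density h₀).2]
      · intro b _ hb; simp [hb]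
      · simp
    · rw [Finset.sum_eq_single (fun _ => false)]
      · simp only [if_true, qubitTensor_mul, qubitTensor_trace,
          averageProj_mul_optimalQubit_trace h₀, Finset.prod_const, Finset.card_univ,
          Fintype.card_fin]
        rw [← Complex.ofReal_pow, Complex.ofReal_re]
      · intro b _ hb; simp [hb]
      · simp
  · rintro _ ⟨σ, hσ, htr, rfl⟩
    simpa [htr] using sum_trace_averageProj_mul_le h₀ h₁ hσ

/-! ### The guessing game as a one-bit forgery -/

/-- Substituting `τ b = q b • ρ b` merges weights and states; conversely the weight is the trace. -/
theorem winProbs_eq (δ : ℝ) :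
    {p : ℝ | ∃ s : GameStrategy, s.winProb δ = p} =
      {p : ℝ | ∃ τ : Bool → Matrix Bool Bool ℂ, (∀ b, (τ b).PosSemidef) ∧
        ∑ b, (τ b).trace = 1 ∧ ∑ b, ((averageProj δ b * τ b).trace).re = p} := by
  ext p
  constructor
  · rintro ⟨s, rfl⟩
    refine ⟨fun b => (s.q b : ℂ) • s.ρ b, fun b => (s.density b).1.smul ?_, ?_, ?_⟩
    · exact_mod_cast s.q_nonneg b
    · simp only [Matrix.trace_smul, (s.density _).2, smul_eq_mul, mul_one]
      exact_mod_cast s.q_sum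
    · simp only [winProb_eq, Matrix.mul_smul, Matrix.trace_smul, smul_eq_mul,
        Complex.re_ofReal_mul]
  · rintro ⟨τ, hτ, htr, rfl⟩
    have hq : ∀ b, (τ b).trace = (((τ b).trace).re : ℂ) := fun b => trace_eq_re (hτ b)
    have hscale : ∀ b, ∃ ρ : Matrix Bool Bool ℂ, IsDensity ρ ∧
        τ b = (((τ b).trace).re : ℂ) • ρ := by
      intro b
      by_cases h : ((τ b).trace).re = 0
      -- For weight zero, `τ b` vanishes and any density operator serves; this one is `|0⟩⟨0|`.
      · refine ⟨realSym 1 0 0, ⟨realSym_posSemidef (by simp) (by simp) (by simp), ?_⟩, ?_⟩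
        · rw [realSym_trace]; simp
        · rw [h, Complex.ofReal_zero, zero_smul]
          exact (hτ b).trace_eq_zero_iff.mp (by rw [hq, h, Complex.ofReal_zero])
      · have h' : (((τ b).trace).re : ℂ) ≠ 0 := by exact_mod_cast h
        refine ⟨((((τ b).trace).re⁻¹ : ℝ) : ℂ) • τ b, ⟨(hτ b).smul ?_, ?_⟩, ?_⟩
        · exact_mod_cast inv_nonneg.mpr (trace_re_nonneg (hτ b))
        · rw [Matrix.trace_smul, smul_eq_mul, Complex.ofReal_inv]
          nth_rewrite 2 [hq b]
          exact inv_mul_cancel₀ h'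
        · rw [smul_smul, Complex.ofReal_inv, mul_inv_cancel₀ h', one_smul]
    choose ρ hρ hτρ using hscale
    refine ⟨⟨fun b => ((τ b).trace).re, fun b => trace_re_nonneg (hτ b), ?_, ρ, hρ⟩, ?_⟩
    · rw [← Complex.re_sum, htr, Complex.one_re]
    · rw [winProb_eq]
      refine Finset.sum_congr rfl fun b _ => ?_
      conv_rhs => rw [hτρ b]
      rw [Matrix.mul_smul, Matrix.trace_smul, smul_eq_mul, Complex.re_ofReal_mul]

theorem trace_submatrix_equiv {a b : Type} [Fintype a] [Fintype b] (e : a ≃ b)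
    (M : Matrix b b ℂ) : (M.submatrix e e).trace = M.trace :=
  e.sum_comp fun i => M i i

theorem one_bit_acceptProbs_eq_winProbs {δ : ℝ} (h₀ : 0 ≤ δ) (h₁ : δ ≤ 1 / 2)
    {P : ClassicalPUF n (1 + 1)} (hP : P.HasBias δ) {d : ℕ} (hd : 0 < d) :
    {p : ℝ | ∃ A : Adversary n 1, A.queries = 0 ∧ acceptProb P d A = p} =
      {p : ℝ | ∃ s : GameStrategy, s.winProb δ = p} := by
  rw [acceptProbs_without_queries h₀ h₁ hP hd, winProbs_eq]
  let e : Bits 1 ≃ Bool := Equiv.funUnique (Fin 1) Bool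
  have hQ : ∀ b : Bits 1, (qubitTensor fun j => averageProj δ (b j)) =
      (averageProj δ (e b)).submatrix e e := by
    intro b
    ext s t
    simp [qubitTensor, e]
  ext p
  constructor
  · rintro ⟨σ, hσ, htr, rfl⟩
    refine ⟨fun b => (σ (e.symm b)).submatrix e.symm e.symm,
      fun b => (hσ _).submatrix _, ?_, ?_⟩
    · simp only [trace_submatrix_equiv]
      rw [← htr]
      exact e.symm.sum_comp fun b => (σ b).trace
    · rw [← e.symm.sum_comp]
      refine Finset.sum_congr rfl fun b _ => ?_
      rw [hQ, e.apply_symm_apply, ← trace_submatrix_equiv e, ← Matrix.submatrix_mul_equiv _ _ e e e,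
        Matrix.submatrix_submatrix]
      simp
  · rintro ⟨τ, hτ, htr, rfl⟩
    refine ⟨fun b => (τ (e b)).submatrix e e, fun b => (hτ _).submatrix _, ?_, ?_⟩
    · simp only [trace_submatrix_equiv]
      rw [← htr]
      exact e.sum_comp fun b => (τ b).trace
    · simp only [hQ, Matrix.submatrix_mul_equiv, trace_submatrix_equiv]
      exact e.sum_comp fun b => ((averageProj δ b * τ b).trace).re

end Protocol

/-! ### Asymptotics -/

/-- The square root is at most `1` because `4δ² ≤ 1`, so the value is at most `1/2 + δ`. -/
theorem forgeValue_lt_one {δ : ℝ} (h₀ : 0 ≤ δ) (h₁ : δ < 1 / 2) : forgeValue δ < 1 := by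
  have h : Real.sqrt ((1 + 4 * δ ^ 2) / 2) ≤ 1 := by
    refine Real.sqrt_le_iff.mpr ⟨zero_le_one, ?_⟩
    nlinarith
  unfold forgeValue
  nlinarith [mul_le_mul_of_nonneg_left h h₀]

open Filter Asymptotics Topology

theorem superpolynomialDecay_const_pow {c : ℝ} (hc₀ : 0 ≤ c) (hc₁ : c < 1) :
    SuperpolynomialDecay atTop (fun m : ℕ => (m : ℝ)) fun m : ℕ => c ^ m :=
  fun k => tendsto_pow_const_mul_const_pow_of_lt_one k hc₀ hc₁

theorem superpolynomialDecay_pow_of_log_isLittleO {c : ℝ} (hc₀ : 0 < c) (hc₁ : c < 1) {m : ℕ → ℕ}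
    (hm : (fun l : ℕ => Real.log l) =o[atTop] fun l : ℕ => (m l : ℝ)) :
    SuperpolynomialDecay atTop (fun l : ℕ => (l : ℝ)) fun l : ℕ => c ^ m l := by
  intro k
  have hlog : 0 < -Real.log c := neg_pos.mpr (Real.log_neg hc₀ hc₁)
  -- With this constant, eventually `l ^ (k + 1) * c ^ m l ≤ 1`; the spare power of `l` leaves the
  -- bound `1 / l`, which tends to zero.
  have hε : 0 < -Real.log c / (k + 1) := by positivity
  refine squeeze_zero' (Eventually.of_forall fun l => by positivity) ?_
    (tendsto_inv_atTop_zero.comp tendsto_natCast_atTop_atTop)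
  filter_upwards [hm.bound hε, eventually_gt_atTop 0] with l hl hl0
  have hl' : (0 : ℝ) < l := by exact_mod_cast hl0
  have h1 : (k + 1) * Real.log l ≤ -Real.log c * m l := by
    have h2 : Real.log l ≤ -Real.log c / (k + 1) * m l := by
      refine (le_abs_self _).trans ?_
      simpa using hl
    rw [div_mul_eq_mul_div, le_div_iff₀ (by positivity)] at h2
    linarith
  have h3 : (l : ℝ) ^ (k + 1) * c ^ m l ≤ 1 := by
    rw [← Real.log_nonpos_iff (by positivity), Real.log_mul (by positivity) (by positivity),
      Real.log_pow, Real.log_pow]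
    push_cast
    linarith
  simp only [Function.comp]
  rw [← one_div, le_div_iff₀ hl']
  calc _ = (l : ℝ) ^ (k + 1) * c ^ m l := by ring
    _ ≤ 1 := h3

theorem superpolynomialDecay_acceptProb {δ : ℝ} (h₀ : 0 ≤ δ) (h₁ : δ < 1 / 2) {n m d : ℕ → ℕ}
    (hd : ∀ l, 0 < d l)
    (hn : (fun l : ℕ => Real.log l) =o[atTop] fun l : ℕ => (n l : ℝ))
    (hm : (fun l : ℕ => Real.log l) =o[atTop] fun l : ℕ => (m l : ℝ))
    {P : ∀ l, ClassicalPUF (n l) (m l + m l)} (hP : ∀ l, (P l).HasBias δ)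
    (A : ∀ l, Adversary (n l) (m l)) {r : Polynomial ℕ} (hr : ∀ l, (A l).queries ≤ r.eval l) :
    SuperpolynomialDecay atTop (fun l : ℕ => (l : ℝ))
      fun l : ℕ => acceptProb (P l) (d l) (A l) := by
  have hv : 0 < forgeValue δ := by unfold forgeValue; positivity
  have d1 := superpolynomialDecay_pow_of_log_isLittleO hv (forgeValue_lt_one h₀ h₁) hm
  have d2 := (superpolynomialDecay_pow_of_log_isLittleO (c := 1 / 2) (by norm_num) (by norm_num)
    hn).mul_polynomial (r.map (Nat.castRingHom ℝ))
  refine (d1.add d2).trans_abs_le fun l => ?_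
  rw [abs_of_nonneg (acceptProb_nonneg h₀ h₁.le (hP l) (hd l) (A l))]
  refine le_trans ?_ (le_abs_self _)
  refine (acceptProb_le h₀ h₁.le (hP l) (hd l) (A l)).trans ?_
  simp only [Pi.add_apply]
  gcongr
  have e : (r.map (Nat.castRingHom ℝ)).eval (l : ℝ) = ((r.eval l : ℕ) : ℝ) := by
    simp
  rw [e, one_div, inv_pow, div_eq_inv_mul]
  gcongr
  exact hr l

end OnlineAuth

theorem theorem4 (δ : ℝ) (hδ₀ : 0 ≤ δ) (hδ₁ : δ ≤ 1 / 2) :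
    -- the optimal winning probability of the guessing game
    IsGreatest {p : ℝ | ∃ s : GameStrategy, s.winProb δ = p} (forgeValue δ) ∧
    -- local indistinguishability: the emitted qubits are maximally mixed for every response,
    -- so that they do not help to guess an encoded bit, whatever its prior distribution
    (∀ (m : ℕ) (y : Bits (m + m)), sentState y = ((2 : ℂ) ^ m)⁻¹ • 1) ∧
    (∀ w : ℝ, 0 ≤ w → w ≤ 1 →
      IsGreatest (discriminationProbs w (sentQubit false) (sentQubit true)) (max w (1 - w))) ∧
    -- the optimal guess of the basis bit from qubit and announced outcome is the prior guess
    (∀ b : Bool, IsGreatest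
      (discriminationProbs (1 / 2 + δ) (collapsedQubit δ false b) (collapsedQubit δ true b))
      (1 / 2 + δ)) ∧
    -- the protocol with `m` pairs of response bits
    (∀ (n m d : ℕ), 0 < d → ∀ P : ClassicalPUF n (m + m), P.HasBias δ →
      IsGreatest {p : ℝ | ∃ A : Adversary n m, A.queries = 0 ∧ acceptProb P d A = p}
        (forgeValue δ ^ m) ∧
      (∀ A : Adversary n m, freshAcceptProb P d A ≤ forgeValue δ ^ m * freshProb P d A) ∧
      (∀ A : Adversary n m,
        acceptProb P d A ≤ forgeValue δ ^ m + (A.queries : ℝ) / 2 ^ n)) ∧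
    -- the protocol and the game are equivalent for one bit
    (∀ (n d : ℕ), 0 < d → ∀ P : ClassicalPUF n (1 + 1), P.HasBias δ →
      {p : ℝ | ∃ A : Adversary n 1, A.queries = 0 ∧ acceptProb P d A = p} =
        {p : ℝ | ∃ s : GameStrategy, s.winProb δ = p}) ∧
    -- asymptotic security
    (δ < 1 / 2 →
      Asymptotics.SuperpolynomialDecay Filter.atTop (fun m : ℕ => (m : ℝ))
        (fun m : ℕ => forgeValue δ ^ m) ∧
      ∀ n m d : ℕ → ℕ, (∀ l, 0 < d l) →
        (fun l : ℕ => Real.log l) =o[Filter.atTop] (fun l : ℕ => (n l : ℝ)) →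
        (fun l : ℕ => Real.log l) =o[Filter.atTop] (fun l : ℕ => (m l : ℝ)) →
        ∀ P : ∀ l, ClassicalPUF (n l) (m l + m l), (∀ l, (P l).HasBias δ) →
        ∀ A : ∀ l, Adversary (n l) (m l),
          (∃ r : Polynomial ℕ, ∀ l, (A l).queries ≤ r.eval l) →
          Asymptotics.SuperpolynomialDecay Filter.atTop (fun l : ℕ => (l : ℝ))
            (fun l : ℕ => acceptProb (P l) (d l) (A l))) := by
  refine ⟨isGreatest_winProb hδ₀, fun _ y => sentState_eq y,
    fun w _ _ => isGreatest_discriminationProbs_maximallyMixed w,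
    isGreatest_discriminationProbs_collapsedQubit hδ₀ hδ₁,
    fun n m d hd P hP => ⟨isGreatest_acceptProb_without_queries hδ₀ hδ₁ hP hd,
      freshAcceptProb_le hδ₀ hδ₁ hP hd, acceptProb_le hδ₀ hδ₁ hP hd⟩,
    fun n d hd P hP => one_bit_acceptProbs_eq_winProbs hδ₀ hδ₁ hP hd, fun hδ => ⟨?_, ?_⟩⟩
  · exact superpolynomialDecay_const_pow (forgeValue_nonneg hδ₀) (forgeValue_lt_one hδ₀ hδ)
  · rintro n m d hd hn hm P hP A ⟨r, hr⟩
    exact superpolynomialDecay_acceptProb hδ₀ hδ hd hn hm hP A hr
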